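/- Let $\beta>0$ and $L>0$. For a regular curve $y$ in $\mathbb R^3$ with curvature $\kappa$ and arc length $s$ put $\mathcal E(y)=\int\sqrt{\kappa^2+\beta^2}\,ds$. A curve $x:[0,L]\to\mathbb R^3$ is called a stationary curve (of the problem $\mathbf{P_{curve}}$) if it is $C^1$ on $[0,L]$, smooth and parametrized by arc length on $(0,L)$, has integrable curvature (finite in the interior, possibly infinite at the ends), satisfies $x(0)=0$, $\dot x(0)=e_z$, $x(L)=x_1$, $\dot x(L)=n_1\in S^2$, and $\frac{d}{d\tau}\mathcal E(x_\tau)|_{\tau=0}=0$ for every smooth family $x_\tau$ of curves (of any length) with $x_0=x$ that agree with $x$ near both ends. Let $\omega^1,\dots,\omega^6$ be the left-invariant coframe of $SE(3)=\mathbb R^3\rtimes SO(3)$ dual to the left-invariant fields $\mathcal A_1,\mathcal A_2,\mathcal A_3$ (translations along the $x,y,z$-axes) and $\mathcal A_4,\mathcal A_5,\mathcal A_6$ (rotations about the $x,y,z$-axes). Let $Z$ be the 15-dimensional manifold of points $(g,\kappa_1,\kappa_2,\sigma,\lambda_1,\dots,\lambda_6)$ with $g=(x,R)\in SE(3)$,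 $\kappa_i,\lambda_i\in\mathbb R$, $\sigma>0$. On curves $r\mapsto\Gamma(r)\in Z$, with $ds=\sigma\,dr$ and $\kappa=\sqrt{\kappa_1^2+\kappa_2^2}$, put $$\theta^1=\omega^1,\ \theta^2=\omega^2,\ \theta^3=\omega^3-ds,\ \theta^4=\omega^4+\kappa_2ds,\ \theta^5=\omega^5-\kappa_1ds,\ \theta^6=\omega^6,\qquad \psi=\sqrt{\kappa^2+\beta^2}\,ds+\sum_{i=1}^6\lambda_i\theta^i .$$ A smooth curve $\Gamma:(0,L)\to Z$ is called stationary if for every $[a,b]\subset(0,L)$ and every smooth family $N_\tau$ of curves in $Z$ with $N_0=\Gamma$ which keeps the position $x$ and the direction $Re_z$ at $a$ and $b$ fixed, $\frac{d}{d\tau}\int_{[a,b]}N_\tau^*\psi\,|_{\tau=0}=0$. (1) Every stationary curve $x$ of $\mathbf{P_{curve}}$ has a smooth horizontal lift $g=(x,R)$ on $(0,L)$, i.e. $Re_z=\dot x$ and $\omega^1(\dot g)=\omega^2(\dot g)=\omega^6(\dot g)=0$, and for every such lift there are $\kappa_1,\kappa_2,\lambda_1,\dots,\lambda_6$ such that $\Gamma=(g,\kappa_1,\kappa_2,1,\lambda_1,\dots,\lambda_6)$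 is stationary in $Z$. (2) Let $\Gamma=(g,\kappa_1,\kappa_2,\sigma,\lambda_1,\dots,\lambda_6)$ be stationary in $Z$ with $\sigma\equiv1$. Then all $\theta^i$ vanish along $\Gamma$, and $\kappa=\sqrt{\kappa_1^2+\kappa_2^2}$ is the curvature of the spatial part of $\Gamma$. With the normalized curvature $\mathbf w=(w_1,w_2)=(\kappa_1,\kappa_2)/\sqrt{\kappa^2+\beta^2}$ one has on $(0,L)$ $$\lambda_1=-\dot w_1,\quad \lambda_2=-\dot w_2,\quad \lambda_3=\beta\sqrt{1-\|\mathbf w\|^2},\quad \lambda_4=-w_2,\quad \lambda_5=w_1,\quad \lambda_6=0,$$ and $\ddot{\mathbf w}=\beta^2\mathbf w$. The limits $\mathbf w(0)=\lim_{s\downarrow0}\mathbf w(s)$ and $\dot{\mathbf w}(0)=\lim_{s\downarrow0}\dot{\mathbf w}(s)$ exist, and $$\mathbf w(s)=\cosh(\beta s)\,\mathbf w(0)+\frac{\sinh(\beta s)}{\beta}\,\dot{\mathbf w}(0).$$ With $\mathfrak c=\sqrt{1-\|\mathbf w(0)\|^2+\beta^{-2}\|\dot{\mathbf w}(0)\|^2}$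 one has $\mathfrak c>0$, and along the whole curve $$\lambda_1^2+\lambda_2^2+\lambda_3^2=\mathfrak c^2\beta^2,\qquad \beta^{-2}\lambda_3^2+\lambda_4^2+\lambda_5^2=1 .$$ -/

import Mathlib

open Set Filter Topology MeasureTheory
open scoped ContDiff Matrix

noncomputable section

namespace CuspGeo

/-- Euclidean three-space. -/
abbrev E3 : Type := EuclideanSpace ℝ (Fin 3)

/-- Euclidean plane, in which the pair of signed curvatures `(κ₁, κ₂)` lives. -/
abbrev E2 : Type := EuclideanSpace ℝ (Fin 2)

/-- Real `3 × 3` matrices. -/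
abbrev M3 : Type := Matrix (Fin 3) (Fin 3) ℝ

/-- The unit vector `e_z`. -/
def ez : E3 := EuclideanSpace.single 2 1

/-! ### The energy of a spatial curve and its stationary points -/

/-- Unit tangent vector of a regular curve in an arbitrary parameter. -/
def unitTangent (y : ℝ → E3) (r : ℝ) : E3 := ‖deriv y r‖⁻¹ • deriv y r

/-- Absolute curvature of a regular curve in an arbitrary parameter: the norm of the derivative of
the unit tangent with respect to arc length. -/
def curvature (y : ℝ → E3) (r : ℝ) : ℝ := ‖deriv (unitTangent y) r‖ / ‖deriv y r‖

/-- The energy `∫ √(κ² + β²) ds` of a regular curve with parameter interval `(0, L)`, where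
`ds = ‖y'(r)‖ dr`.  It does not depend on the parametrization, so the length of `y` is free. -/
def energy (β L : ℝ) (y : ℝ → E3) : ℝ :=
  ∫ r in (0 : ℝ)..L, √(curvature y r ^ 2 + β ^ 2) * ‖deriv y r‖

/-- A smooth one-parameter family `τ ↦ F τ` of curves on `(0, L)` through `x = F 0` that keeps the
curve fixed near both ends, hence keeps the end points and the end directions. -/
structure IsVariation (L : ℝ) (x : ℝ → E3) (F : ℝ → ℝ → E3) : Prop where
  smooth : ContDiffOn ℝ ∞ (Function.uncurry F) (univ ×ˢ Ioo 0 L)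
  start : ∀ s ∈ Ioo 0 L, F 0 s = x s
  compact : ∃ a b : ℝ, 0 < a ∧ b < L ∧ ∀ τ, ∀ s ∈ Ioo 0 L, s ∉ Icc a b → F τ s = x s

/-- `x : [0, L] → ℝ³` is a stationary curve, parametrized by arc length and of length `L`, of the
energy among all curves (of any length) that go from `0` with direction `e_z` to `x₁` with
direction `n₁`.  The curve is `C¹` up to the ends and its curvature is integrable; the curvature
is finite (and the curve smooth) in the interior, but may become infinite at the two ends. -/
structure IsStationaryCurve (β L : ℝ) (x₁ n₁ : E3) (x : ℝ → E3) : Prop where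
  continuousOn : ContinuousOn x (Icc 0 L)
  smooth : ContDiffOn ℝ ∞ x (Ioo 0 L)
  unit_speed : ∀ s ∈ Ioo 0 L, ‖deriv x s‖ = 1
  pos_zero : x 0 = 0
  pos_end : x L = x₁
  dir_zero : Tendsto (deriv x) (𝓝[>] 0) (𝓝 ez)
  dir_end : Tendsto (deriv x) (𝓝[<] L) (𝓝 n₁)
  integrable : IntervalIntegrable (curvature x) volume 0 L
  stationary : ∀ F, IsVariation L x F → HasDerivAt (fun τ => energy β L (F τ)) 0 0

/-! ### The group `SE(3)`, its left-invariant frame and coframe -/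

/-- A rigid motion `(x, R)` of three-space. -/
structure SE3 where
  /-- the translation part -/
  pos : E3
  /-- the rotation part -/
  rot : Matrix.specialOrthogonalGroup (Fin 3) ℝ

/-- The rotation part as a matrix. -/
def SE3.mat (g : SE3) : M3 := (g.rot : M3)

/-- The direction `R e_z`; `(pos, dir)` is the point of `SE(3) / ({0} ⋊ SO(2))` below `g`. -/
def SE3.dir (g : SE3) : E3 := WithLp.toLp 2 (g.mat *ᵥ WithLp.ofLp ez)

/-- The basis `A₁, …, A₆` of the tangent space at the unit `(0, I)`: the translations along, and
the infinitesimal rotations about, the `x`-, `y`- and `z`-axis.  A tangent vector of `SE(3)` is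
written as a pair (velocity of `x`, velocity of `R`). -/
def lieBasis : Fin 6 → E3 × M3 :=
  ![(EuclideanSpace.single 0 1, 0), (EuclideanSpace.single 1 1, 0), (EuclideanSpace.single 2 1, 0),
    (0, !![0, 0, 0; 0, 0, -1; 0, 1, 0]),
    (0, !![0, 0, 1; 0, 0, 0; -1, 0, 0]),
    (0, !![0, -1, 0; 1, 0, 0; 0, 0, 0])]

/-- The left-invariant vector fields `𝒜₁, …, 𝒜₆` at `g`: images of `A₁, …, A₆` under the
differential of `(x, R) ↦ g (x, R) = (x_g + R_g x, R_g R)`. -/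
def frame (g : SE3) (j : Fin 6) : E3 × M3 :=
  (WithLp.toLp 2 (g.mat *ᵥ WithLp.ofLp (lieBasis j).1), g.mat * (lieBasis j).2)

/-- The left-invariant coframe `ω¹, …, ω⁶` at `g` (indexed from `0`), applied to the tangent
vector `(v, V)`. -/
def coframe (g : SE3) (v : E3) (V : M3) : Fin 6 → ℝ :=
  ![(g.matᵀ *ᵥ WithLp.ofLp v) 0, (g.matᵀ *ᵥ WithLp.ofLp v) 1, (g.matᵀ *ᵥ WithLp.ofLp v) 2,
    (g.matᵀ * V) 2 1, (g.matᵀ * V) 0 2, (g.matᵀ * V) 1 0]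

/-- `⟨ωⁱ, 𝒜ⱼ⟩ = δⁱⱼ`. -/
theorem coframe_frame (g : SE3) (i j : Fin 6) :
    coframe g (frame g j).1 (frame g j).2 i = if i = j then 1 else 0 := by
  have h : g.matᵀ * g.mat = 1 := by
    have := (Matrix.mem_specialOrthogonalGroup_iff.1 g.rot.2).1
    exact (Matrix.mem_orthogonalGroup_iff' (Fin 3) ℝ).1 this
  have h1 : ∀ v : Fin 3 → ℝ, g.matᵀ *ᵥ (g.mat *ᵥ v) = v := fun v => by
    rw [Matrix.mulVec_mulVec, h, Matrix.one_mulVec]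
  have h2 : ∀ V : M3, g.matᵀ * (g.mat * V) = V := fun V => by
    rw [← Matrix.mul_assoc, h, Matrix.one_mul]
  simp only [coframe, frame, h1, h2]
  fin_cases j <;> fin_cases i <;> simp [lieBasis]

/-- Velocity of the rotation part of a curve in `SE(3)`, entry by entry. -/
def rotVel (g : ℝ → SE3) (r : ℝ) : M3 := Matrix.of fun i j => deriv (fun q => (g q).mat i j) r

/-- The numbers `⟨ωⁱ, g'(r)⟩` along a curve in `SE(3)`. -/
def coframeAlong (g : ℝ → SE3) (r : ℝ) : Fin 6 → ℝ :=
  coframe (g r) (deriv (fun q => (g q).pos) r) (rotVel g r)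

/-- `g = (x, R)` is a horizontal lift of the unit speed curve `x` on `(0, L)`:
`R e_z = ẋ`, and `g` is smooth and tangent to `ker ω¹ ∩ ker ω² ∩ ker ω⁶`. -/
structure IsHorizontalLift (L : ℝ) (x : ℝ → E3) (g : ℝ → SE3) : Prop where
  pos_eq : ∀ s ∈ Ioo 0 L, (g s).pos = x s
  dir_eq : ∀ s ∈ Ioo 0 L, (g s).dir = deriv x s
  smooth : ∀ i j, ContDiffOn ℝ ∞ (fun s => (g s).mat i j) (Ioo 0 L)
  horizontal : ∀ s ∈ Ioo 0 L,
    coframeAlong g s 0 = 0 ∧ coframeAlong g s 1 = 0 ∧ coframeAlong g s 5 = 0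

/-! ### The extended manifold, the form `ψ` and its stationary curves -/

/-- A point `(g, κ₁, κ₂, σ, λ₁, …, λ₆)` of the 15-dimensional manifold `Z`; the `λᵢ` are the
coordinates of the covector `∑ λᵢ ωⁱ` at `g`. -/
structure Z where
  /-- the rigid motion -/
  g : SE3
  /-- the two signed curvatures -/
  κ : E2
  /-- the spatial speed -/
  σ : {t : ℝ // 0 < t}
  /-- the Lagrange multipliers, indexed from `0` -/
  lam : Fin 6 → ℝ

/-- The values on `Γ'(r)` of the six Pfaffian forms `ω¹`, `ω²`, `ω³ - ds`, `ω⁴ + κ₂ ds`,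
`ω⁵ - κ₁ ds`, `ω⁶`, where `ds = σ dr`. -/
def theta (Γ : ℝ → Z) (r : ℝ) : Fin 6 → ℝ :=
  ![coframeAlong (fun q => (Γ q).g) r 0,
    coframeAlong (fun q => (Γ q).g) r 1,
    coframeAlong (fun q => (Γ q).g) r 2 - ((Γ r).σ : ℝ),
    coframeAlong (fun q => (Γ q).g) r 3 + (Γ r).κ 1 * ((Γ r).σ : ℝ),
    coframeAlong (fun q => (Γ q).g) r 4 - (Γ r).κ 0 * ((Γ r).σ : ℝ),
    coframeAlong (fun q => (Γ q).g) r 5]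

/-- The value on `Γ'(r)` of the one-form `ψ = √(‖κ‖² + β²) ds + ∑ λᵢ θⁱ`. -/
def psi (β : ℝ) (Γ : ℝ → Z) (r : ℝ) : ℝ :=
  √(‖(Γ r).κ‖ ^ 2 + β ^ 2) * ((Γ r).σ : ℝ) + ∑ i, (Γ r).lam i * theta Γ r i

/-- Smoothness, in coordinates, of a map from a subset of a normed space to `Z`. -/
structure SmoothOn {E : Type} [NormedAddCommGroup E] [NormedSpace ℝ E] (f : E → Z) (U : Set E) :
    Prop where
  pos : ContDiffOn ℝ ∞ (fun p => (f p).g.pos) U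
  rot : ∀ i j, ContDiffOn ℝ ∞ (fun p => (f p).g.mat i j) U
  κ : ContDiffOn ℝ ∞ (fun p => (f p).κ) U
  σ : ContDiffOn ℝ ∞ (fun p => ((f p).σ : ℝ)) U
  lam : ∀ i, ContDiffOn ℝ ∞ (fun p => (f p).lam i) U

/-- A smooth one-parameter family `τ ↦ N τ` of curves in `Z` through `Γ = N 0` for which the
position and the direction at the parameters `a` and `b` stay fixed.  Nothing else is prescribed
there: the boundary data are points of `SE(3) / ({0} ⋊ SO(2))`. -/
structure IsPerturbation (L a b : ℝ) (Γ : ℝ → Z) (N : ℝ → ℝ → Z) : Prop where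
  smooth : SmoothOn (Function.uncurry N) (univ ×ˢ Ioo 0 L)
  start : ∀ r ∈ Ioo 0 L, N 0 r = Γ r
  left : ∀ τ, (N τ a).g.pos = (Γ a).g.pos ∧ (N τ a).g.dir = (Γ a).g.dir
  right : ∀ τ, (N τ b).g.pos = (Γ b).g.pos ∧ (N τ b).g.dir = (Γ b).g.dir

/-- `Γ` is a smooth stationary curve of `∫ ψ` on `(0, L)`: on every compact portion `[a, b]`, the
derivative of `∫ ψ` vanishes along all perturbations that fix the boundary data.  (The ends `0`
and `L` are reached through portions, since the curvatures may be infinite there.) -/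
structure IsStationaryZ (β L : ℝ) (Γ : ℝ → Z) : Prop where
  smooth : SmoothOn Γ (Ioo 0 L)
  stationary : ∀ a b : ℝ, 0 < a → a < b → b < L → ∀ N, IsPerturbation L a b Γ N →
    HasDerivAt (fun τ => ∫ r in a..b, psi β (N τ) r) 0 0

/-- The normalized curvature `w = (κ₁, κ₂) / √(κ² + β²)`, `κ = √(κ₁² + κ₂²)`. -/
def normCurv (β : ℝ) (Γ : ℝ → Z) (s : ℝ) : E2 := (√(‖(Γ s).κ‖ ^ 2 + β ^ 2))⁻¹ • (Γ s).κ

end CuspGeo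

end

/-! Everything rests on one first-variation formula in `SE(3)`. Let ξ be the velocity of a family of
curves in its parameter τ, read in the left-invariant frame. Since ∂τ and ∂r commute, the
Maurer-Cartan equations (`partialFst_coframeAlong`) express ∂τ of ωⁱ(∂r g) as ∂r ξⁱ plus bracket
terms. The product rule then gives ∂τ ψ = (Euler-Lagrange form) + d/dr ∑ λᵢ ξⁱ (`partialFst_psi`).

The explicit variations `perturb` show that stationarity forces the Euler-Lagrange form to vanish
pointwise. The ends of a portion fix only position and direction, so rotation about the moving
z-axis remains free there, and the boundary term gives λ₆ = 0. These conditions are also sufficient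
(`isStationaryZ_of_eulerLagrange`).

For part (2), write E = √(κ²+β²). The equations in coordinates (`eulerLagrange_eq_zero_iff`) give θ
= 0, w = (λ₅, -λ₄) and λ₃ = E - κ²/E = β²/E. The multipliers evolve by the coadjoint equation
`momentumRate`. At unit speed this reads λ₄' = λ₂, λ₅' = -λ₁ and (λ₁, λ₂)' = -λ₃(κ₁, κ₂), so w'' =
λ₃(κ₁, κ₂) = β²w: nonlinear in κ, linear in w. Solving this equation supplies the limits at 0 and
the conservation laws; c > 0 because λ₃ > 0.

For part (1), varying x along φ v with v constant and integrating by parts twice yields a constant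
vector P = ((β²-κ²)/E) x' - (x''/E)' (`hasDerivAt_curveMomentum`). Given a horizontal lift (x, R),
take RᵀP as (λ₁, λ₂, λ₃) and (-w₂, w₁, 0) as the rest. The first three coadjoint equations say that
P is constant in space; the others, and the value of λ₃, come from differentiating the body
coordinates (w₁, w₂, 0) of x''/E. Lifts exist because the cone over the curve of unit tangents is
too thin to fill ℝ³: the cross product with a vector off the cone gives a smooth frame, and a
z-rotation then removes ω⁶. -/

noncomputable section

namespace CuspGeo

/-! ### Calculus of two-parameter families and the fundamental lemma. -/

section Calculus

variable {E : Type*} [NormedAddCommGroup E] [NormedSpace ℝ E]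

/-- Partial derivative of a family of curves in the family parameter. -/
def partialFst (F : ℝ → ℝ → E) (t r : ℝ) : E := deriv (fun q => F q r) t

/-- Partial derivative of a family of curves in the curve parameter. -/
def partialSnd (F : ℝ → ℝ → E) (t r : ℝ) : E := deriv (F t) r

variable {F : ℝ → ℝ → E} {W : Set (ℝ × ℝ)} {t r : ℝ}

theorem hasDerivAt_fst_of_differentiableAt
    (h : DifferentiableAt ℝ (Function.uncurry F) (t, r)) :
    HasDerivAt (fun q => F q r) (fderiv ℝ (Function.uncurry F) (t, r) (1, 0)) t :=
  h.hasFDerivAt.comp_hasDerivAt t (f := fun q => (q, r))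
    ((hasDerivAt_id t).prodMk (hasDerivAt_const t r))

theorem hasDerivAt_snd_of_differentiableAt
    (h : DifferentiableAt ℝ (Function.uncurry F) (t, r)) :
    HasDerivAt (F t) (fderiv ℝ (Function.uncurry F) (t, r) (0, 1)) r :=
  h.hasFDerivAt.comp_hasDerivAt r (f := fun q => (t, q))
    ((hasDerivAt_const r t).prodMk (hasDerivAt_id r))

theorem differentiableAt_uncurry (hW : IsOpen W) (hF : ContDiffOn ℝ ∞ (Function.uncurry F) W)
    (h : (t, r) ∈ W) : DifferentiableAt ℝ (Function.uncurry F) (t, r) :=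
  (hF.contDiffAt (hW.mem_nhds h)).differentiableAt (by simp)

theorem hasDerivAt_partialFst (hW : IsOpen W) (hF : ContDiffOn ℝ ∞ (Function.uncurry F) W)
    (h : (t, r) ∈ W) : HasDerivAt (fun q => F q r) (partialFst F t r) t :=
  (hasDerivAt_fst_of_differentiableAt
    (differentiableAt_uncurry hW hF h)).differentiableAt.hasDerivAt

theorem hasDerivAt_partialSnd (hW : IsOpen W) (hF : ContDiffOn ℝ ∞ (Function.uncurry F) W)
    (h : (t, r) ∈ W) : HasDerivAt (F t) (partialSnd F t r) r :=
  (hasDerivAt_snd_of_differentiableAt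
    (differentiableAt_uncurry hW hF h)).differentiableAt.hasDerivAt

theorem partialFst_eq_fderiv (hW : IsOpen W) (hF : ContDiffOn ℝ ∞ (Function.uncurry F) W)
    (h : (t, r) ∈ W) : partialFst F t r = fderiv ℝ (Function.uncurry F) (t, r) (1, 0) :=
  (hasDerivAt_fst_of_differentiableAt (differentiableAt_uncurry hW hF h)).deriv

theorem partialSnd_eq_fderiv (hW : IsOpen W) (hF : ContDiffOn ℝ ∞ (Function.uncurry F) W)
    (h : (t, r) ∈ W) : partialSnd F t r = fderiv ℝ (Function.uncurry F) (t, r) (0, 1) :=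
  (hasDerivAt_snd_of_differentiableAt (differentiableAt_uncurry hW hF h)).deriv

theorem contDiffOn_partialFst (hW : IsOpen W) (hF : ContDiffOn ℝ ∞ (Function.uncurry F) W) :
    ContDiffOn ℝ ∞ (Function.uncurry (partialFst F)) W :=
  ((hF.fderiv_of_isOpen hW (m := ∞) le_rfl).clm_apply contDiffOn_const).congr
    fun p hp => partialFst_eq_fderiv (t := p.1) (r := p.2) hW hF hp

theorem contDiffOn_partialSnd (hW : IsOpen W) (hF : ContDiffOn ℝ ∞ (Function.uncurry F) W) :
    ContDiffOn ℝ ∞ (Function.uncurry (partialSnd F)) W :=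
  ((hF.fderiv_of_isOpen hW (m := ∞) le_rfl).clm_apply contDiffOn_const).congr
    fun p hp => partialSnd_eq_fderiv (t := p.1) (r := p.2) hW hF hp

theorem partialFst_partialSnd (hW : IsOpen W) (hF : ContDiffOn ℝ ∞ (Function.uncurry F) W)
    (h : (t, r) ∈ W) :
    partialFst (partialSnd F) t r = partialSnd (partialFst F) t r := by
  have hc : ContDiffAt ℝ ∞ (Function.uncurry F) (t, r) := hF.contDiffAt (hW.mem_nhds h)
  have hd : DifferentiableAt ℝ (fderiv ℝ (Function.uncurry F)) (t, r) :=
    (hc.fderiv_right (m := 1) (by norm_cast)).differentiableAt (by simp)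
  have key : ∀ v w : ℝ × ℝ, fderiv ℝ (fun p => fderiv ℝ (Function.uncurry F) p v) (t, r) w =
      fderiv ℝ (fderiv ℝ (Function.uncurry F)) (t, r) w v := fun v w => by
    rw [fderiv_clm_apply hd (differentiableAt_const v)]; simp
  rw [partialFst_eq_fderiv hW (contDiffOn_partialSnd hW hF) h,
    partialSnd_eq_fderiv hW (contDiffOn_partialFst hW hF) h,
    Filter.EventuallyEq.fderiv_eq (f₁ := Function.uncurry (partialSnd F))
      (f := fun p => fderiv ℝ (Function.uncurry F) p (0, 1)),
    Filter.EventuallyEq.fderiv_eq (f₁ := Function.uncurry (partialFst F))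
      (f := fun p => fderiv ℝ (Function.uncurry F) p (1, 0)), key, key]
  · exact (hc.isSymmSndFDerivAt (by simp; norm_cast)) _ _
  · filter_upwards [hW.mem_nhds h] with p hp using
      partialFst_eq_fderiv (t := p.1) (r := p.2) hW hF hp
  · filter_upwards [hW.mem_nhds h] with p hp using
      partialSnd_eq_fderiv (t := p.1) (r := p.2) hW hF hp

theorem contDiffOn_slice_snd {s : Set ℝ} (hF : ContDiffOn ℝ ∞ (Function.uncurry F) W)
    (h : ∀ r ∈ s, (t, r) ∈ W) : ContDiffOn ℝ ∞ (F t) s :=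
  hF.comp (t := W) (f := fun r => (t, r)) (by fun_prop) h

/-- Differentiation under the integral sign for a family that is smooth near a compact slice. -/
theorem hasDerivAt_intervalIntegral [CompleteSpace E] {a b : ℝ} (hab : a ≤ b) (hW : IsOpen W)
    (hF : ContDiffOn ℝ ∞ (Function.uncurry F) W) (h : ∀ r ∈ Icc a b, (t, r) ∈ W) :
    HasDerivAt (fun q => ∫ r in a..b, F q r) (∫ r in a..b, partialFst F t r) t := by
  -- The compact slice thickens to a box inside `W`; on a smaller compact box the derivative in the
  -- parameter has a constant bound, which serves as the dominating function.
  obtain ⟨u, v, hu, -, htu, hbv, huv⟩ := generalized_tube_lemma (isCompact_singleton (x := t))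
    (isCompact_Icc (a := a) (b := b)) hW (by rintro ⟨p, q⟩ ⟨rfl, hq⟩; exact h q hq)
  obtain ⟨ε, hε, hεu⟩ := Metric.nhds_basis_closedBall.mem_iff.1
    (hu.mem_nhds (htu (mem_singleton t)))
  have hsub : Metric.closedBall t ε ×ˢ Icc a b ⊆ W := (prod_mono hεu hbv).trans huv
  have hcont : ContinuousOn (Function.uncurry (partialFst F)) (Metric.closedBall t ε ×ˢ Icc a b) :=
    (contDiffOn_partialFst hW hF).continuousOn.mono hsub
  obtain ⟨C, hC⟩ := ((isCompact_closedBall t ε).prod isCompact_Icc).exists_bound_of_continuousOn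
    hcont
  have hslice : ∀ q ∈ Metric.closedBall t ε, ContinuousOn (F q) (Icc a b) := fun q hq =>
    (contDiffOn_slice_snd hF fun r hr => hsub ⟨hq, hr⟩).continuousOn
  have ht : t ∈ Metric.closedBall t ε := Metric.mem_closedBall_self hε.le
  have hIoc : uIoc a b ⊆ Icc a b := by rw [uIoc_of_le hab]; exact Ioc_subset_Icc_self
  refine (intervalIntegral.hasDerivAt_integral_of_dominated_loc_of_deriv_le
    (F' := partialFst F) (bound := fun _ => C) (s := Metric.closedBall t ε)
    (Metric.closedBall_mem_nhds t hε) ?_ ?_ ?_ ?_ ?_ ?_).2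
  · filter_upwards [Metric.closedBall_mem_nhds t hε] with q hq
    exact ((hslice q hq).mono hIoc).aestronglyMeasurable measurableSet_uIoc
  · exact (hslice t ht).intervalIntegrable_of_Icc hab
  · exact ((contDiffOn_slice_snd (contDiffOn_partialFst hW hF)
      fun r hr => hsub ⟨ht, hIoc hr⟩).continuousOn).aestronglyMeasurable measurableSet_uIoc
  · exact ae_of_all _ fun r hr q hq => hC (q, r) ⟨hq, hIoc hr⟩
  · exact intervalIntegrable_const
  · exact ae_of_all _ fun r hr q hq => hasDerivAt_partialFst hW hF (hsub ⟨hq, hIoc hr⟩)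

/-- The fundamental lemma of the calculus of variations on an open interval. -/
theorem eqOn_zero_of_integral_smul_eq_zero [CompleteSpace E] {f : ℝ → E} {a b : ℝ}
    (hf : ContinuousOn f (Ioo a b))
    (h : ∀ φ : ℝ → ℝ, ContDiff ℝ ∞ φ → HasCompactSupport φ → tsupport φ ⊆ Ioo a b →
      ∫ r in a..b, φ r • f r = 0) : ∀ r ∈ Ioo a b, f r = 0 := by
  rcases le_or_gt b a with hab | hab
  · intro r hr; exact absurd (hr.1.trans hr.2) hab.not_gt
  have hae : ∀ᵐ r, r ∈ Ioo a b → f r = 0 := by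
    refine isOpen_Ioo.ae_eq_zero_of_integral_contDiff_smul_eq_zero
      (hf.locallyIntegrableOn measurableSet_Ioo) fun φ hφ hc hs => ?_
    rw [← h φ hφ hc hs, intervalIntegral.integral_of_le hab.le,
      ← setIntegral_eq_integral_of_forall_compl_eq_zero (s := Ioc a b)]
    intro r hr
    rw [image_eq_zero_of_notMem_tsupport fun h' => hr (Ioo_subset_Ioc_self (hs h')), zero_smul]
  exact Measure.eqOn_open_of_ae_eq ((ae_restrict_iff' measurableSet_Ioo).2 hae) isOpen_Ioo hf
    continuousOn_const

end Calculus

/-! ### The Maurer-Cartan equations of `SE(3)` -/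

theorem SE3.transpose_mul_mat (g : SE3) : g.matᵀ * g.mat = 1 :=
  (Matrix.mem_orthogonalGroup_iff' (Fin 3) ℝ).1 (Matrix.mem_specialOrthogonalGroup_iff.1 g.rot.2).1

theorem SE3.mat_mul_transpose (g : SE3) : g.mat * g.matᵀ = 1 :=
  mul_eq_one_comm.1 g.transpose_mul_mat

theorem SE3.sum_mat_mul_mat (g : SE3) (a b : Fin 3) :
    ∑ k, g.mat k a * g.mat k b = if a = b then 1 else 0 := by
  simpa [Matrix.mul_apply, Matrix.one_apply] using congrFun₂ g.transpose_mul_mat a b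

theorem SE3.dir_apply (g : SE3) (k : Fin 3) : g.dir k = g.mat k 2 := by
  simp [SE3.dir, ez]

/-- The translational velocity in body coordinates. -/
def posForm (g : ℝ → SE3) (r : ℝ) : Fin 3 → ℝ :=
  (g r).matᵀ *ᵥ WithLp.ofLp (deriv (fun q => (g q).pos) r)

/-- The angular velocity matrix in body coordinates. -/
def rotForm (g : ℝ → SE3) (r : ℝ) : M3 := (g r).matᵀ * rotVel g r

theorem coframeAlong_eq (g : ℝ → SE3) (r : ℝ) :
    coframeAlong g r = ![posForm g r 0, posForm g r 1, posForm g r 2,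
      rotForm g r 2 1, rotForm g r 0 2, rotForm g r 1 0] := rfl

theorem rotVel_eq_mul (g : ℝ → SE3) (r : ℝ) : rotVel g r = (g r).mat * rotForm g r := by
  rw [rotForm, ← Matrix.mul_assoc, SE3.mat_mul_transpose, Matrix.one_mul]

/-- Differentiating RᵀR = I puts RᵀR' in so(3). -/
theorem rotForm_antisymm {g : ℝ → SE3} {r : ℝ}
    (h : ∀ i j, DifferentiableAt ℝ (fun q => (g q).mat i j) r) (a b : Fin 3) :
    rotForm g r a b = -rotForm g r b a := by
  have h1 : HasDerivAt (fun q => ∑ k, (g q).mat k a * (g q).mat k b)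
      (∑ k, (rotVel g r k a * (g r).mat k b + (g r).mat k a * rotVel g r k b)) r :=
    HasDerivAt.fun_sum (u := Finset.univ) fun k _ => (h k a).hasDerivAt.mul (h k b).hasDerivAt
  simp only [SE3.sum_mat_mul_mat] at h1
  have h2 := h1.unique (hasDerivAt_const r _)
  rw [Finset.sum_add_distrib] at h2
  have h3 : rotForm g r b a = ∑ k, rotVel g r k a * (g r).mat k b := by
    simp [rotForm, Matrix.mul_apply, mul_comm]
  have h4 : rotForm g r a b = ∑ k, (g r).mat k a * rotVel g r k b := by
    simp [rotForm, Matrix.mul_apply]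
  linarith

/-- The bracket terms in the Maurer-Cartan equations, for the components `η` and `ξ` of two
commuting tangent vectors. -/
def maurerCartan (η ξ : Fin 6 → ℝ) : Fin 6 → ℝ :=
  ![η 4 * ξ 2 - η 5 * ξ 1 - (ξ 4 * η 2 - ξ 5 * η 1),
    η 5 * ξ 0 - η 3 * ξ 2 - (ξ 5 * η 0 - ξ 3 * η 2),
    η 3 * ξ 1 - η 4 * ξ 0 - (ξ 3 * η 1 - ξ 4 * η 0),
    η 4 * ξ 5 - η 5 * ξ 4, η 5 * ξ 3 - η 3 * ξ 5, η 3 * ξ 4 - η 4 * ξ 3]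

/-- Smoothness, in coordinates, of a two-parameter family of rigid motions. -/
structure SmoothFamily (G : ℝ → ℝ → SE3) (W : Set (ℝ × ℝ)) : Prop where
  isOpen : IsOpen W
  pos : ContDiffOn ℝ ∞ (Function.uncurry fun t r => (G t r).pos) W
  rot : ∀ i j, ContDiffOn ℝ ∞ (Function.uncurry fun t r => (G t r).mat i j) W

theorem hasDerivAt_apply {ι : Type*} [Fintype ι] {f : ℝ → EuclideanSpace ℝ ι}
    {f' : EuclideanSpace ℝ ι} {r : ℝ} (h : HasDerivAt f f' r) (k : ι) :
    HasDerivAt (fun q => f q k) (f' k) r :=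
  (EuclideanSpace.proj (𝕜 := ℝ) k).hasFDerivAt.comp_hasDerivAt r h

namespace SmoothFamily

variable {G : ℝ → ℝ → SE3} {W : Set (ℝ × ℝ)} {t r : ℝ}

theorem contDiffOn_snd (h : SmoothFamily G W) (i : Fin 6) :
    ContDiffOn ℝ ∞ (Function.uncurry fun t r => coframeAlong (G t) r i) W := by
  have hp : ∀ a, ContDiffOn ℝ ∞ (Function.uncurry fun t r => posForm (G t) r a) W := fun a =>
    ContDiffOn.sum (s := Finset.univ) fun k _ =>
      (h.rot k a).mul (contDiffOn_euclidean.1 (contDiffOn_partialSnd h.isOpen h.pos) k)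
  have hr : ∀ a b, ContDiffOn ℝ ∞ (Function.uncurry fun t r => rotForm (G t) r a b) W :=
    fun a b => ContDiffOn.sum (s := Finset.univ) fun k _ =>
      (h.rot k a).mul (contDiffOn_partialSnd h.isOpen (h.rot k b))
  fin_cases i
  exacts [hp 0, hp 1, hp 2, hr 2 1, hr 0 2, hr 1 0]

theorem contDiffOn_fst (h : SmoothFamily G W) (i : Fin 6) :
    ContDiffOn ℝ ∞ (Function.uncurry fun t r => coframeAlong (fun q => G q r) t i) W := by
  have hp : ∀ a, ContDiffOn ℝ ∞ (Function.uncurry fun t r => posForm (fun q => G q r) t a) W :=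
    fun a => ContDiffOn.sum (s := Finset.univ) fun k _ =>
      (h.rot k a).mul (contDiffOn_euclidean.1 (contDiffOn_partialFst h.isOpen h.pos) k)
  have hr : ∀ a b, ContDiffOn ℝ ∞
      (Function.uncurry fun t r => rotForm (fun q => G q r) t a b) W :=
    fun a b => ContDiffOn.sum (s := Finset.univ) fun k _ =>
      (h.rot k a).mul (contDiffOn_partialFst h.isOpen (h.rot k b))
  fin_cases i
  exacts [hp 0, hp 1, hp 2, hr 2 1, hr 0 2, hr 1 0]

theorem hasDerivAt_fst (h : SmoothFamily G W) (hW : (t, r) ∈ W) (i j : Fin 3) :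
    HasDerivAt (fun q => (G q r).mat i j) (rotVel (fun q => G q r) t i j) t :=
  hasDerivAt_partialFst h.isOpen (h.rot i j) hW

theorem hasDerivAt_snd (h : SmoothFamily G W) (hW : (t, r) ∈ W) (i j : Fin 3) :
    HasDerivAt (fun q => (G t q).mat i j) (rotVel (G t) r i j) r :=
  hasDerivAt_partialSnd h.isOpen (h.rot i j) hW

/-- Both sides differentiate Rᵀ times a first derivative of the position. The mixed second
derivatives agree, so only the derivatives of Rᵀ survive, and these form the bracket. -/
theorem partial_posForm (h : SmoothFamily G W) (hW : (t, r) ∈ W) (a : Fin 3) :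
    partialFst (fun t r => posForm (G t) r a) t r =
      partialSnd (fun t r => posForm (fun q => G q r) t a) t r +
        ∑ c, (rotForm (G t) r a c * posForm (fun q => G q r) t c -
          rotForm (fun q => G q r) t a c * posForm (G t) r c) := by
  set P : ℝ → ℝ → E3 := fun t r => (G t r).pos
  have h1 : HasDerivAt (fun q => posForm (G q) r a)
      (∑ k, (rotVel (fun q => G q r) t k a * partialSnd P t r k +
        (G t r).mat k a * partialFst (partialSnd P) t r k)) t :=
    HasDerivAt.fun_sum (u := Finset.univ) fun k _ => (h.hasDerivAt_fst hW k a).mul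
      (hasDerivAt_apply (hasDerivAt_partialFst h.isOpen (contDiffOn_partialSnd h.isOpen h.pos) hW) k)
  have h2 : HasDerivAt (fun q => posForm (fun q' => G q' q) t a)
      (∑ k, (rotVel (G t) r k a * partialFst P t r k +
        (G t r).mat k a * partialSnd (partialFst P) t r k)) r :=
    HasDerivAt.fun_sum (u := Finset.univ) fun k _ => (h.hasDerivAt_snd hW k a).mul
      (hasDerivAt_apply (hasDerivAt_partialSnd h.isOpen (contDiffOn_partialFst h.isOpen h.pos) hW) k)
  refine h1.deriv.trans (Eq.trans ?_ (congrArg (· + _) h2.deriv.symm))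
  rw [partialFst_partialSnd h.isOpen h.pos hW]
  -- With R' = RΩ and Ω antisymmetric, (R')ᵀv = -Ω Rᵀv. Two curves appear because the velocity is
  -- taken along one parameter line and the body coordinates along the other, through the same
  -- point.
  have key : ∀ (g g' : ℝ → SE3) (s s' : ℝ) (v : E3), g s = g' s' →
      (∀ i j, DifferentiableAt ℝ (fun q => (g q).mat i j) s) →
      ∑ k, rotVel g s k a * v k =
        -∑ c, rotForm g s a c * ((g' s').matᵀ *ᵥ WithLp.ofLp v) c := by
    intro g g' s s' v hg hd
    have e1 : ∑ k, rotVel g s k a * v k = ((rotVel g s)ᵀ *ᵥ WithLp.ofLp v) a := rfl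
    have e2 : (rotForm g s)ᵀ = -rotForm g s := by
      ext i j; simpa using rotForm_antisymm hd j i
    rw [e1, rotVel_eq_mul, Matrix.transpose_mul, ← Matrix.mulVec_mulVec, e2, Matrix.neg_mulVec, hg]
    rfl
  simp only [Finset.sum_add_distrib, Finset.sum_sub_distrib]
  rw [key (fun q => G q r) (G t) t r (partialSnd P t r) rfl
      fun i j => (h.hasDerivAt_fst hW i j).differentiableAt,
    key (G t) (fun q => G q r) r t (partialFst P t r) rfl
      fun i j => (h.hasDerivAt_snd hW i j).differentiableAt]
  simp only [posForm, P, partialSnd, partialFst]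
  ring

theorem partial_rotForm (h : SmoothFamily G W) (hW : (t, r) ∈ W) (a b : Fin 3) :
    partialFst (fun t r => rotForm (G t) r a b) t r =
      partialSnd (fun t r => rotForm (fun q => G q r) t a b) t r +
        ∑ c, (rotForm (G t) r a c * rotForm (fun q => G q r) t c b -
          rotForm (fun q => G q r) t a c * rotForm (G t) r c b) := by
  have h1 : HasDerivAt (fun q => rotForm (G q) r a b)
      (∑ k, (rotVel (fun q => G q r) t k a * rotVel (G t) r k b + (G t r).mat k a *
        partialFst (partialSnd fun t r => (G t r).mat k b) t r)) t :=
    HasDerivAt.fun_sum (u := Finset.univ) fun k _ => (h.hasDerivAt_fst hW k a).mul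
      (hasDerivAt_partialFst h.isOpen (contDiffOn_partialSnd h.isOpen (h.rot k b)) hW)
  have h2 : HasDerivAt (fun q => rotForm (fun q' => G q' q) t a b)
      (∑ k, (rotVel (G t) r k a * rotVel (fun q => G q r) t k b + (G t r).mat k a *
        partialSnd (partialFst fun t r => (G t r).mat k b) t r)) r :=
    HasDerivAt.fun_sum (u := Finset.univ) fun k _ => (h.hasDerivAt_snd hW k a).mul
      (hasDerivAt_partialSnd h.isOpen (contDiffOn_partialFst h.isOpen (h.rot k b)) hW)
  refine h1.deriv.trans (Eq.trans ?_ (congrArg (· + _) h2.deriv.symm))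
  simp only [partialFst_partialSnd h.isOpen (h.rot _ b) hW]
  have key : ∀ (g g' : ℝ → SE3) (s s' : ℝ), g s = g' s' →
      (∀ i j, DifferentiableAt ℝ (fun q => (g q).mat i j) s) →
      ∑ k, rotVel g s k a * rotVel g' s' k b =
        -∑ c, rotForm g s a c * rotForm g' s' c b := by
    intro g g' s s' hg hd
    have e1 : ∑ k, rotVel g s k a * rotVel g' s' k b = ((rotVel g s)ᵀ * rotVel g' s') a b := rfl
    have e2 : (rotForm g s)ᵀ = -rotForm g s := by
      ext i j; simpa using rotForm_antisymm hd j i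
    rw [e1, rotVel_eq_mul g, Matrix.transpose_mul, Matrix.mul_assoc, e2, Matrix.neg_mul, hg]
    rfl
  simp only [Finset.sum_add_distrib, Finset.sum_sub_distrib]
  rw [key (fun q => G q r) (G t) t r rfl
      fun i j => (h.hasDerivAt_fst hW i j).differentiableAt,
    key (G t) (fun q => G q r) r t rfl
      fun i j => (h.hasDerivAt_snd hW i j).differentiableAt]
  ring

/-- The structure equation for dωⁱ evaluated on (∂t, ∂r). Antisymmetry lets the three rotational
components determine the whole angular velocity matrix, so the matrix identities become the six
coordinate ones. -/
theorem partialFst_coframeAlong (h : SmoothFamily G W) (hW : (t, r) ∈ W) (i : Fin 6) :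
    partialFst (fun t r => coframeAlong (G t) r i) t r =
      partialSnd (fun t r => coframeAlong (fun q => G q r) t i) t r +
        maurerCartan (coframeAlong (G t) r) (coframeAlong (fun q => G q r) t) i := by
  have a1 := rotForm_antisymm (g := G t) (r := r)
    fun i j => (h.hasDerivAt_snd hW i j).differentiableAt
  have a2 := rotForm_antisymm (g := fun q => G q r) (r := t)
    fun i j => (h.hasDerivAt_fst hW i j).differentiableAt
  have d1 : ∀ c, rotForm (G t) r c c = 0 := fun c => by linarith [a1 c c]
  have d2 : ∀ c, rotForm (fun q => G q r) t c c = 0 := fun c => by linarith [a2 c c]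
  fin_cases i
  · refine (h.partial_posForm hW 0).trans (congrArg _ ?_)
    simp [Fin.sum_univ_three, maurerCartan, coframeAlong_eq, d1, d2, a1 0 1, a2 0 1]; ring
  · refine (h.partial_posForm hW 1).trans (congrArg _ ?_)
    simp [Fin.sum_univ_three, maurerCartan, coframeAlong_eq, d1, d2, a1 1 2, a2 1 2]; ring
  · refine (h.partial_posForm hW 2).trans (congrArg _ ?_)
    simp [Fin.sum_univ_three, maurerCartan, coframeAlong_eq, d1, d2, a1 2 0, a2 2 0]; ring
  · refine (h.partial_rotForm hW 2 1).trans (congrArg _ ?_)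
    simp [Fin.sum_univ_three, maurerCartan, coframeAlong_eq, d1, d2, a1 2 0, a2 2 0, a1 0 1, a2 0 1]
    ring
  · refine (h.partial_rotForm hW 0 2).trans (congrArg _ ?_)
    simp [Fin.sum_univ_three, maurerCartan, coframeAlong_eq, d1, d2, a1 0 1, a2 0 1, a1 1 2, a2 1 2]
    ring
  · refine (h.partial_rotForm hW 1 0).trans (congrArg _ ?_)
    simp [Fin.sum_univ_three, maurerCartan, coframeAlong_eq, d1, d2, a1 1 2, a2 1 2, a1 2 0, a2 2 0]
    ring

end SmoothFamily

/-! ### The first variation of `∫ ψ` -/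

theorem E2.norm_sq (v : E2) : ‖v‖ ^ 2 = v 0 ^ 2 + v 1 ^ 2 := by
  simp [EuclideanSpace.norm_sq_eq]

theorem normCurv_apply (β : ℝ) (Γ : ℝ → Z) (s : ℝ) (k : Fin 2) :
    normCurv β Γ s k = (Γ s).κ k / √(‖(Γ s).κ‖ ^ 2 + β ^ 2) := by
  simp [normCurv, div_eq_inv_mul]

/-- The rate of change of the momentum `l` (in body coordinates) of a rigid motion with velocity
`η` in the absence of forces. -/
def momentumRate (η l : Fin 6 → ℝ) : Fin 6 → ℝ :=
  ![η 5 * l 1 - η 4 * l 2, η 3 * l 2 - η 5 * l 0, η 4 * l 0 - η 3 * l 1,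
    η 5 * l 4 - η 4 * l 5 - (η 1 * l 2 - η 2 * l 1),
    η 3 * l 5 - η 5 * l 3 - (η 2 * l 0 - η 0 * l 2),
    η 4 * l 3 - η 3 * l 4 - (η 0 * l 1 - η 1 * l 0)]

/-- `momentumRate η` is the transpose of the bracket with η, that is, the coadjoint action. This
moves the bracket off ξ so that ξ can be varied freely. -/
theorem sum_mul_maurerCartan (η ξ l : Fin 6 → ℝ) :
    ∑ i, l i * maurerCartan η ξ i = ∑ i, momentumRate η l i * ξ i := by
  simp [Fin.sum_univ_six, maurerCartan, momentumRate]
  ring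

/-- The Euler-Lagrange one-form of `∫ ψ` along `Γ`, paired with a variation: `k`, `s` and `m` are
the variations of `κ`, `σ` and `lam`, and `ξ` is that of `g` in the left-invariant frame. -/
def eulerLagrange (β : ℝ) (Γ : ℝ → Z) (k : E2) (s : ℝ) (m ξ : Fin 6 → ℝ) (r : ℝ) : ℝ :=
  ((Γ r).σ : ℝ) * ((normCurv β Γ r 0 - (Γ r).lam 4) * k 0 + (normCurv β Γ r 1 + (Γ r).lam 3) * k 1)
    + (√(‖(Γ r).κ‖ ^ 2 + β ^ 2) - (Γ r).lam 2 + (Γ r).lam 3 * (Γ r).κ 1 - (Γ r).lam 4 * (Γ r).κ 0)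
      * s
    + ∑ i, theta Γ r i * m i
    + ∑ i, (momentumRate (coframeAlong (fun q => (Γ q).g) r) (Γ r).lam i
        - deriv (fun q => (Γ q).lam i) r) * ξ i

section theta

theorem vec_zero (a b c d e f : ℝ) : ![a, b, c, d, e, f] 0 = a := rfl

theorem vec_one (a b c d e f : ℝ) : ![a, b, c, d, e, f] 1 = b := rfl

theorem vec_two (a b c d e f : ℝ) : ![a, b, c, d, e, f] 2 = c := rfl

theorem vec_three (a b c d e f : ℝ) : ![a, b, c, d, e, f] 3 = d := rfl

theorem vec_four (a b c d e f : ℝ) : ![a, b, c, d, e, f] 4 = e := rfl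

theorem vec_five (a b c d e f : ℝ) : ![a, b, c, d, e, f] 5 = f := rfl

variable (Γ : ℝ → Z) (r : ℝ)

theorem theta_zero : theta Γ r 0 = coframeAlong (fun q => (Γ q).g) r 0 := vec_zero ..

theorem theta_one : theta Γ r 1 = coframeAlong (fun q => (Γ q).g) r 1 := vec_one ..

theorem theta_two : theta Γ r 2 = coframeAlong (fun q => (Γ q).g) r 2 - ((Γ r).σ : ℝ) := vec_two ..

theorem theta_three :
    theta Γ r 3 = coframeAlong (fun q => (Γ q).g) r 3 + (Γ r).κ 1 * ((Γ r).σ : ℝ) := vec_three ..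

theorem theta_four :
    theta Γ r 4 = coframeAlong (fun q => (Γ q).g) r 4 - (Γ r).κ 0 * ((Γ r).σ : ℝ) := vec_four ..

theorem theta_five : theta Γ r 5 = coframeAlong (fun q => (Γ q).g) r 5 := vec_five ..

end theta

theorem psi_eq (β : ℝ) (Γ : ℝ → Z) (r : ℝ) :
    psi β Γ r = √((Γ r).κ 0 ^ 2 + (Γ r).κ 1 ^ 2 + β ^ 2) * ((Γ r).σ : ℝ)
      + ∑ i, (Γ r).lam i * coframeAlong (fun q => (Γ q).g) r i
      + ((Γ r).lam 3 * (Γ r).κ 1 - (Γ r).lam 4 * (Γ r).κ 0 - (Γ r).lam 2) * ((Γ r).σ : ℝ) := by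
  rw [psi, E2.norm_sq]
  simp only [Fin.sum_univ_six, theta_zero, theta_one, theta_two, theta_three, theta_four,
    theta_five]
  ring

theorem SmoothOn.smoothFamily {N : ℝ → ℝ → Z} {W : Set (ℝ × ℝ)}
    (h : SmoothOn (Function.uncurry N) W) (hW : IsOpen W) :
    SmoothFamily (fun t r => (N t r).g) W :=
  ⟨hW, h.pos, h.rot⟩

theorem contDiffOn_psi {β : ℝ} (hβ : 0 < β) {N : ℝ → ℝ → Z} {W : Set (ℝ × ℝ)} (hW : IsOpen W)
    (h : SmoothOn (Function.uncurry N) W) :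
    ContDiffOn ℝ ∞ (Function.uncurry fun t r => psi β (N t) r) W := by
  have hκ : ∀ k, ContDiffOn ℝ ∞ (fun p : ℝ × ℝ => (N p.1 p.2).κ k) W :=
    contDiffOn_euclidean.1 h.κ
  have hσ : ContDiffOn ℝ ∞ (fun p : ℝ × ℝ => ((N p.1 p.2).σ : ℝ)) W := h.σ
  have hl : ∀ i, ContDiffOn ℝ ∞ (fun p : ℝ × ℝ => (N p.1 p.2).lam i) W := h.lam
  have hsum : ContDiffOn ℝ ∞ (fun p : ℝ × ℝ =>
      ∑ i, (N p.1 p.2).lam i * coframeAlong (fun q => (N p.1 q).g) p.2 i) W :=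
    ContDiffOn.sum fun i _ => (hl i).mul ((h.smoothFamily hW).contDiffOn_snd i)
  have : ContDiffOn ℝ ∞ (fun p : ℝ × ℝ =>
      √((N p.1 p.2).κ 0 ^ 2 + (N p.1 p.2).κ 1 ^ 2 + β ^ 2)) W :=
    (((hκ 0).pow 2).add ((hκ 1).pow 2) |>.add contDiffOn_const).sqrt fun p _ => by positivity
  refine ((this.mul hσ).add hsum |>.add
    (((((hl 3).mul (hκ 1)).sub ((hl 4).mul (hκ 0))).sub (hl 2)).mul hσ)).congr fun p _ => ?_
  exact psi_eq β (N p.1) p.2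

/-- Integration by parts done pointwise: λᵢ ∂r ξⁱ = ∂r(λᵢ ξⁱ) - λᵢ' ξⁱ, with the bracket terms
transposed onto λ. The remaining terms are ordinary partial derivatives in κ, σ and λ. -/
theorem partialFst_psi {β : ℝ} (hβ : 0 < β) {N : ℝ → ℝ → Z} {W : Set (ℝ × ℝ)} (hW : IsOpen W)
    (h : SmoothOn (Function.uncurry N) W) {t r : ℝ} (hp : (t, r) ∈ W) :
    partialFst (fun t r => psi β (N t) r) t r =
      eulerLagrange β (N t) (partialFst (fun t r => (N t r).κ) t r)
        (partialFst (fun t r => ((N t r).σ : ℝ)) t r)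
        (fun i => partialFst (fun t r => (N t r).lam i) t r)
        (coframeAlong (fun q => (N q r).g) t) r +
      deriv (fun q => ∑ i, (N t q).lam i * coframeAlong (fun p => (N p q).g) t i) r := by
  have hG := h.smoothFamily hW
  have hκ : ∀ k, HasDerivAt (fun q => (N q r).κ k) (partialFst (fun t r => (N t r).κ) t r k) t :=
    hasDerivAt_apply (hasDerivAt_partialFst (F := fun t r => (N t r).κ) hW h.κ hp)
  have hσ := hasDerivAt_partialFst (F := fun t r => ((N t r).σ : ℝ)) hW h.σ hp
  have hl := fun i => hasDerivAt_partialFst (F := fun t r => (N t r).lam i) hW (h.lam i) hp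
  have hl' : ∀ i, HasDerivAt (fun q => (N t q).lam i) (deriv (fun q => (N t q).lam i) r) r :=
    fun i => hasDerivAt_partialSnd (F := fun t r => (N t r).lam i) hW (h.lam i) hp
  have hc := fun i => hasDerivAt_partialFst hW (hG.contDiffOn_snd i) hp
  have hx := fun i => hasDerivAt_partialSnd hW (hG.contDiffOn_fst i) hp
  have hpos : 0 < (N t r).κ 0 ^ 2 + (N t r).κ 1 ^ 2 + β ^ 2 := by positivity
  have hE := ((((hκ 0).fun_pow 2).fun_add ((hκ 1).fun_pow 2)).add_const (β ^ 2)).sqrt hpos.ne'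
  have hd := ((hE.fun_mul hσ).fun_add
    (HasDerivAt.fun_sum (u := Finset.univ) fun i _ => (hl i).fun_mul (hc i))).fun_add
    (((((hl 3).fun_mul (hκ 1)).fun_sub ((hl 4).fun_mul (hκ 0))).fun_sub (hl 2)).fun_mul hσ)
  have hb : deriv (fun q => ∑ i, (N t q).lam i * coframeAlong (fun p => (N p q).g) t i) r = _ :=
    (HasDerivAt.fun_sum (u := Finset.univ) fun i _ => (hl' i).fun_mul (hx i)).deriv
  have hψ : partialFst (fun t r => psi β (N t) r) t r = _ :=
    (hd.congr_of_eventuallyEq (f₁ := fun q => psi β (N q) r)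
      (Eventually.of_forall fun q => psi_eq β (N q) r)).deriv
  rw [hψ, hb]
  simp only [hG.partialFst_coframeAlong hp, mul_add, Finset.sum_add_distrib, sum_mul_maurerCartan,
    eulerLagrange, sub_mul, Finset.sum_sub_distrib, normCurv_apply, E2.norm_sq]
  have hE0 : √((N t r).κ 0 ^ 2 + (N t r).κ 1 ^ 2 + β ^ 2) ≠ 0 := (Real.sqrt_pos.2 hpos).ne'
  generalize √((N t r).κ 0 ^ 2 + (N t r).κ 1 ^ 2 + β ^ 2) = E at hE0 ⊢
  have hth : ∑ i, theta (N t) r i * partialFst (fun t r => (N t r).lam i) t r =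
      ∑ i, partialFst (fun t r => (N t r).lam i) t r * coframeAlong (fun q => (N t q).g) r i
      - partialFst (fun t r => (N t r).lam 2) t r * ((N t r).σ : ℝ)
      + partialFst (fun t r => (N t r).lam 3) t r * ((N t r).κ 1 * ((N t r).σ : ℝ))
      - partialFst (fun t r => (N t r).lam 4) t r * ((N t r).κ 0 * ((N t r).σ : ℝ)) := by
    simp only [Fin.sum_univ_six, theta_zero, theta_one, theta_two, theta_three, theta_four,
      theta_five]
    ring
  rw [hth]
  field_simp
  push_cast
  ring

theorem hasDerivAt_integral_psi {β L a b : ℝ} (hβ : 0 < β) (ha : 0 < a) (hab : a ≤ b) (hb : b < L)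
    {N : ℝ → ℝ → Z} (h : SmoothOn (Function.uncurry N) (univ ×ˢ Ioo 0 L)) (t : ℝ) :
    HasDerivAt (fun q => ∫ r in a..b, psi β (N q) r)
      ((∫ r in a..b, eulerLagrange β (N t) (partialFst (fun t r => (N t r).κ) t r)
        (partialFst (fun t r => ((N t r).σ : ℝ)) t r)
        (fun i => partialFst (fun t r => (N t r).lam i) t r)
        (coframeAlong (fun q => (N q r).g) t) r) +
      (∑ i, (N t b).lam i * coframeAlong (fun p => (N p b).g) t i -
        ∑ i, (N t a).lam i * coframeAlong (fun p => (N p a).g) t i)) t := by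
  have hW : IsOpen (univ ×ˢ Ioo 0 L : Set (ℝ × ℝ)) := isOpen_univ.prod isOpen_Ioo
  have hsub : Icc a b ⊆ Ioo 0 L := fun r hr => ⟨ha.trans_le hr.1, hr.2.trans_lt hb⟩
  have hmem : ∀ r ∈ Ioo 0 L, (t, r) ∈ (univ ×ˢ Ioo 0 L : Set (ℝ × ℝ)) := fun r hr => ⟨trivial, hr⟩
  have hψ := contDiffOn_psi hβ hW h
  have hd := hasDerivAt_intervalIntegral (t := t) hab hW hψ fun r hr => hmem r (hsub hr)
  have hB : ContDiffOn ℝ ∞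
      (fun q => ∑ i, (N t q).lam i * coframeAlong (fun p => (N p q).g) t i) (Ioo 0 L) :=
    ContDiffOn.sum fun i _ =>
      (contDiffOn_slice_snd (F := fun t r => (N t r).lam i) (h.lam i) hmem).mul
      (contDiffOn_slice_snd ((h.smoothFamily hW).contDiffOn_fst i) hmem)
  have hB' : ContinuousOn
      (deriv fun q => ∑ i, (N t q).lam i * coframeAlong (fun p => (N p q).g) t i) (Icc a b) :=
    (hB.continuousOn_deriv_of_isOpen isOpen_Ioo (by simp)).mono hsub
  have hψ' : ContinuousOn (partialFst (fun t r => psi β (N t) r) t) (Icc a b) :=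
    (contDiffOn_slice_snd (contDiffOn_partialFst hW hψ) hmem).continuousOn.mono hsub
  have hFTC := intervalIntegral.integral_eq_sub_of_hasDerivAt (a := a) (b := b)
    (f := fun q => ∑ i, (N t q).lam i * coframeAlong (fun p => (N p q).g) t i)
    (fun r hr => by
      rw [uIcc_of_le hab] at hr
      exact ((hB.contDiffAt (isOpen_Ioo.mem_nhds (hsub hr))).differentiableAt (by simp)).hasDerivAt)
    (hB'.intervalIntegrable_of_Icc hab)
  refine hd.congr_deriv (Eq.symm ?_)
  rw [← hFTC, ← eq_sub_iff_add_eq, ← intervalIntegral.integral_sub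
    (hψ'.intervalIntegrable_of_Icc hab) (hB'.intervalIntegrable_of_Icc hab)]
  refine intervalIntegral.integral_congr fun r hr => ?_
  rw [uIcc_of_le hab] at hr
  exact eq_sub_of_add_eq (partialFst_psi hβ hW h (hmem r (hsub hr))).symm

/-! ### Stationary curves are the solutions of the Euler-Lagrange equations -/

theorem coframeAlong_congr {g g' : ℝ → SE3} {r : ℝ} (h : g =ᶠ[𝓝 r] g') :
    coframeAlong g r = coframeAlong g' r := by
  have h1 : rotVel g r = rotVel g' r := by
    ext i j
    exact (h.fun_comp fun g => g.mat i j).deriv_eq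
  have h2 : deriv (fun q => (g q).pos) r = deriv (fun q => (g' q).pos) r :=
    (h.fun_comp SE3.pos).deriv_eq
  rw [coframeAlong, coframeAlong, h1, h2, h.self_of_nhds]

theorem eulerLagrange_congr {Γ Γ' : ℝ → Z} {r : ℝ} (h : Γ =ᶠ[𝓝 r] Γ') (β : ℝ) (k : E2) (s : ℝ)
    (m ξ : Fin 6 → ℝ) : eulerLagrange β Γ k s m ξ r = eulerLagrange β Γ' k s m ξ r := by
  have h1 : coframeAlong (fun q => (Γ q).g) r = coframeAlong (fun q => (Γ' q).g) r :=
    coframeAlong_congr (h.fun_comp Z.g)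
  have h2 : ∀ i, deriv (fun q => (Γ q).lam i) r = deriv (fun q => (Γ' q).lam i) r := fun i =>
    (h.fun_comp fun z => z.lam i).deriv_eq
  simp only [eulerLagrange, theta, normCurv, h1, h2, h.self_of_nhds]

/-- A curve of rigid motions that fixes the position and the direction moves by rotation about
its own `z`-axis only. -/
theorem coframeAlong_eq_zero_of_const {g : ℝ → SE3} {t : ℝ} {p n : E3}
    (h : ∀ i j, DifferentiableAt ℝ (fun q => (g q).mat i j) t)
    (hp : ∀ q, (g q).pos = p) (hn : ∀ q, (g q).dir = n) :
    ∀ i, i ≠ 5 → coframeAlong g t i = 0 := by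
  have h1 : posForm g t = 0 := by
    simp [posForm, hp]
  have h2 : ∀ a, rotForm g t a 2 = 0 := fun a => by
    have : ∀ k, rotVel g t k 2 = 0 := fun k => by
      simp [rotVel, ← SE3.dir_apply, hn]
    simp [rotForm, Matrix.mul_apply, this]
  have h3 : rotForm g t 2 1 = 0 := by rw [rotForm_antisymm h, h2, neg_zero]
  intro i hi
  rw [coframeAlong_eq, h1]
  fin_cases i
  exacts [rfl, rfl, rfl, h3, h2 0, absurd rfl hi]

/-- The integral term vanishes pointwise. At each end an admissible variation can only move `g` by
its own z-rotation, and that component is paired with `lam 5 = 0`. -/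
theorem isStationaryZ_of_eulerLagrange {β L : ℝ} (hβ : 0 < β) {Γ : ℝ → Z}
    (hΓ : SmoothOn Γ (Ioo 0 L))
    (hEL : ∀ r ∈ Ioo 0 L, ∀ k s m ξ, eulerLagrange β Γ k s m ξ r = 0)
    (h5 : ∀ r ∈ Ioo 0 L, (Γ r).lam 5 = 0) : IsStationaryZ β L Γ := by
  refine ⟨hΓ, fun a b ha hab hb N hN => ?_⟩
  have hW : IsOpen (univ ×ˢ Ioo 0 L : Set (ℝ × ℝ)) := isOpen_univ.prod isOpen_Ioo
  have hbd : ∀ r ∈ Ioo 0 L, (∀ τ, (N τ r).g.pos = (Γ r).g.pos ∧ (N τ r).g.dir = (Γ r).g.dir) →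
      ∑ i, (N 0 r).lam i * coframeAlong (fun p => (N p r).g) 0 i = 0 := by
    intro r hr h
    refine Finset.sum_eq_zero fun i _ => ?_
    by_cases hi : i = 5
    · rw [hN.start r hr, hi, h5 r hr, zero_mul]
    · rw [coframeAlong_eq_zero_of_const (g := fun p => (N p r).g) _
        (fun q => (h q).1) (fun q => (h q).2) i hi, mul_zero]
      exact fun i j => ((hN.smooth.smoothFamily hW).hasDerivAt_fst (t := 0) (r := r)
        ⟨trivial, hr⟩ i j).differentiableAt
  refine (hasDerivAt_integral_psi hβ ha hab.le hb hN.smooth 0).congr_deriv ?_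
  rw [hbd a ⟨ha, hab.trans hb⟩ hN.left, hbd b ⟨ha.trans hab, hb⟩ hN.right, sub_zero, add_zero]
  refine (intervalIntegral.integral_congr (g := fun _ => (0 : ℝ)) fun r hr => ?_).trans
    intervalIntegral.integral_zero
  rw [uIcc_of_le hab.le] at hr
  have hr' : r ∈ Ioo 0 L := ⟨ha.trans_le hr.1, hr.2.trans_lt hb⟩
  have hev : N 0 =ᶠ[𝓝 r] Γ := by
    filter_upwards [isOpen_Ioo.mem_nhds hr'] with q hq using hN.start q hq
  exact (eulerLagrange_congr hev ..).trans (hEL r hr' ..)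

/-! ### Explicit test variations built from elementary rotations. -/

/-- Rotation about the `x`-axis. -/
def rotX (t : ℝ) : M3 :=
  !![1, 0, 0; 0, Real.cos t, -Real.sin t; 0, Real.sin t, Real.cos t]

/-- Rotation about the `y`-axis. -/
def rotY (t : ℝ) : M3 :=
  !![Real.cos t, 0, Real.sin t; 0, 1, 0; -Real.sin t, 0, Real.cos t]

/-- Rotation about the `z`-axis. -/
def rotZ (t : ℝ) : M3 :=
  !![Real.cos t, -Real.sin t, 0; Real.sin t, Real.cos t, 0; 0, 0, 1]

theorem mem_SO3 {A : M3} (h : Aᵀ * A = 1) (hd : A.det = 1) :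
    A ∈ Matrix.specialOrthogonalGroup (Fin 3) ℝ :=
  Matrix.mem_specialOrthogonalGroup_iff.2 ⟨(Matrix.mem_orthogonalGroup_iff' (Fin 3) ℝ).2 h, hd⟩

theorem rotX_mem (t : ℝ) : rotX t ∈ Matrix.specialOrthogonalGroup (Fin 3) ℝ := by
  have := Real.sin_sq_add_cos_sq t
  refine mem_SO3 ?_ ?_
  · ext i j
    fin_cases i <;> fin_cases j <;> simp [rotX, Matrix.mul_apply, Fin.sum_univ_three] <;>
      first | ring1 | linear_combination this
  · simp [rotX, Matrix.det_fin_three]; linear_combination this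

theorem rotY_mem (t : ℝ) : rotY t ∈ Matrix.specialOrthogonalGroup (Fin 3) ℝ := by
  have := Real.sin_sq_add_cos_sq t
  refine mem_SO3 ?_ ?_
  · ext i j
    fin_cases i <;> fin_cases j <;> simp [rotY, Matrix.mul_apply, Fin.sum_univ_three] <;>
      first | ring1 | linear_combination this
  · simp [rotY, Matrix.det_fin_three]; linear_combination this

theorem rotZ_mem (t : ℝ) : rotZ t ∈ Matrix.specialOrthogonalGroup (Fin 3) ℝ := by
  have := Real.sin_sq_add_cos_sq t
  refine mem_SO3 ?_ ?_
  · ext i j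
    fin_cases i <;> fin_cases j <;> simp [rotZ, Matrix.mul_apply, Fin.sum_univ_three] <;>
      first | ring1 | linear_combination this
  · simp [rotZ, Matrix.det_fin_three]; linear_combination this

/-- A path of rotations through the identity with prescribed initial angular velocity. -/
def rotPath (z : Fin 3 → ℝ) (t : ℝ) : Matrix.specialOrthogonalGroup (Fin 3) ℝ :=
  ⟨rotX (t * z 0), rotX_mem _⟩ * ⟨rotY (t * z 1), rotY_mem _⟩ * ⟨rotZ (t * z 2), rotZ_mem _⟩

theorem rotPath_coe (z : Fin 3 → ℝ) (t : ℝ) :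
    (rotPath z t : M3) = rotX (t * z 0) * rotY (t * z 1) * rotZ (t * z 2) := rfl

theorem rotX_zero : rotX 0 = 1 := by
  ext i j; fin_cases i <;> fin_cases j <;> simp [rotX]

theorem rotY_zero : rotY 0 = 1 := by
  ext i j; fin_cases i <;> fin_cases j <;> simp [rotY]

theorem rotZ_zero : rotZ 0 = 1 := by
  ext i j; fin_cases i <;> fin_cases j <;> simp [rotZ]

theorem rotPath_zero (z : Fin 3 → ℝ) : (rotPath z 0 : M3) = 1 := by
  simp [rotPath_coe, rotX_zero, rotY_zero, rotZ_zero]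

theorem contDiff_mul_apply {A B : ℝ → M3} (hA : ∀ i j, ContDiff ℝ ∞ fun t => A t i j)
    (hB : ∀ i j, ContDiff ℝ ∞ fun t => B t i j) (i j : Fin 3) :
    ContDiff ℝ ∞ fun t => (A t * B t) i j := by
  simp only [Matrix.mul_apply]
  exact ContDiff.sum fun k _ => (hA i k).mul (hB k j)

theorem hasDerivAt_mul_apply {A B : ℝ → M3} {A' B' : M3} {t : ℝ}
    (hA : ∀ i j, HasDerivAt (fun t => A t i j) (A' i j) t)
    (hB : ∀ i j, HasDerivAt (fun t => B t i j) (B' i j) t) (i j : Fin 3) :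
    HasDerivAt (fun t => (A t * B t) i j) ((A' * B t + A t * B') i j) t := by
  simp only [Matrix.mul_apply, Matrix.add_apply, ← Finset.sum_add_distrib]
  exact HasDerivAt.fun_sum fun k _ => (hA i k).fun_mul (hB k j)

theorem contDiff_rotPath (z : Fin 3 → ℝ) (i j : Fin 3) :
    ContDiff ℝ ∞ fun t => (rotPath z t : M3) i j := by
  have hc : ∀ c : ℝ, ContDiff ℝ ∞ fun t => Real.cos (t * c) := fun c => by fun_prop
  have hs : ∀ c : ℝ, ContDiff ℝ ∞ fun t => Real.sin (t * c) := fun c => by fun_prop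
  refine contDiff_mul_apply (contDiff_mul_apply ?_ ?_) ?_ i j <;> intro i j <;>
    fin_cases i <;> fin_cases j <;>
    first | exact contDiff_const | exact hc _ | exact hs _ | exact (hs _).neg

theorem hasDerivAt_rotPath (z : Fin 3 → ℝ) (i j : Fin 3) :
    HasDerivAt (fun t => (rotPath z t : M3) i j)
      ((!![0, -z 2, z 1; z 2, 0, -z 0; -z 1, z 0, 0] : M3) i j) 0 := by
  have hs : ∀ c : ℝ, HasDerivAt (fun t => Real.sin (t * c)) c 0 := fun c => by
    simpa using ((hasDerivAt_id (0 : ℝ)).mul_const c).sin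
  have hc : ∀ c : ℝ, HasDerivAt (fun t => Real.cos (t * c)) 0 0 := fun c => by
    simpa using ((hasDerivAt_id (0 : ℝ)).mul_const c).cos
  have hX : ∀ i j, HasDerivAt (fun t => rotX (t * z 0) i j)
      ((!![0, 0, 0; 0, 0, -z 0; 0, z 0, 0] : M3) i j) 0 := by
    intro i j
    fin_cases i <;> fin_cases j <;>
      first | exact hasDerivAt_const _ _ | exact hc _ | exact hs _ | exact (hs _).neg
  have hY : ∀ i j, HasDerivAt (fun t => rotY (t * z 1) i j)
      ((!![0, 0, z 1; 0, 0, 0; -z 1, 0, 0] : M3) i j) 0 := by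
    intro i j
    fin_cases i <;> fin_cases j <;>
      first | exact hasDerivAt_const _ _ | exact hc _ | exact hs _ | exact (hs _).neg
  have hZ : ∀ i j, HasDerivAt (fun t => rotZ (t * z 2) i j)
      ((!![0, -z 2, 0; z 2, 0, 0; 0, 0, 0] : M3) i j) 0 := by
    intro i j
    fin_cases i <;> fin_cases j <;>
      first | exact hasDerivAt_const _ _ | exact hc _ | exact hs _ | exact (hs _).neg
  refine (hasDerivAt_mul_apply (hasDerivAt_mul_apply hX hY) hZ i j).congr_deriv ?_
  simp only [zero_mul, rotX_zero, rotY_zero, rotZ_zero, mul_one, one_mul]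
  fin_cases i <;> fin_cases j <;> simp

/-- A pure z-rotation leaves R e_z unchanged, so such variations are admissible even where φ does
not vanish. This is what makes λ₆ accessible. -/
theorem rotPath_apply_two {z : Fin 3 → ℝ} (h0 : z 0 = 0) (h1 : z 1 = 0) (t : ℝ) (i : Fin 3) :
    (rotPath z t : M3) i 2 = (1 : M3) i 2 := by
  simp only [rotPath_coe, h0, h1, mul_zero, rotX_zero, rotY_zero, one_mul]
  fin_cases i <;> simp [rotZ, Matrix.one_apply]

/-- The perturbation of `Γ` with variations `φ k`, `φ s σ`, `φ m` of `κ`, `σ`, `lam`, and `φ ξ` of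
`g` in the left-invariant frame. -/
def perturb (Γ : ℝ → Z) (φ : ℝ → ℝ) (k : E2) (s : ℝ) (m ξ : Fin 6 → ℝ) (t r : ℝ) : Z where
  g := ⟨(Γ r).g.pos + (t * φ r) • WithLp.toLp 2 ((Γ r).g.mat *ᵥ ![ξ 0, ξ 1, ξ 2]),
    (Γ r).g.rot * rotPath ![ξ 3, ξ 4, ξ 5] (t * φ r)⟩
  κ := (Γ r).κ + (t * φ r) • k
  -- The exponential keeps the speed positive for every t; its price is a variation of `σ`
  -- proportional to `σ` itself.
  σ := ⟨((Γ r).σ : ℝ) * Real.exp (t * φ r * s), mul_pos (Γ r).σ.2 (Real.exp_pos _)⟩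
  lam := fun i => (Γ r).lam i + t * φ r * m i

section perturb

variable (Γ : ℝ → Z) (φ : ℝ → ℝ) (k : E2) (s : ℝ) (m ξ : Fin 6 → ℝ) (t r : ℝ)

theorem perturb_mat : (perturb Γ φ k s m ξ t r).g.mat =
    (Γ r).g.mat * (rotPath ![ξ 3, ξ 4, ξ 5] (t * φ r) : M3) := rfl

theorem perturb_eq_of_mul_eq_zero (h : t * φ r = 0) : perturb Γ φ k s m ξ t r = Γ r := by
  have hrot : rotPath ![ξ 3, ξ 4, ξ 5] 0 = 1 := Subtype.ext (rotPath_zero _)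
  simp [perturb, h, hrot]

theorem perturb_zero : perturb Γ φ k s m ξ 0 = Γ :=
  funext fun r => perturb_eq_of_mul_eq_zero Γ φ k s m ξ 0 r (zero_mul _)

variable {Γ φ}

theorem smoothOn_perturb {U : Set ℝ} (hΓ : SmoothOn Γ U) (hφ : ContDiff ℝ ∞ φ) :
    SmoothOn (Function.uncurry (perturb Γ φ k s m ξ)) (univ ×ˢ U) := by
  have hsnd : MapsTo (Prod.snd : ℝ × ℝ → ℝ) (univ ×ˢ U) U := fun p hp => hp.2
  have hu : ContDiffOn ℝ ∞ (fun p : ℝ × ℝ => p.1 * φ p.2) (univ ×ˢ U) :=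
    (contDiff_fst.mul (hφ.comp contDiff_snd)).contDiffOn
  have hm : ∀ i j, ContDiffOn ℝ ∞ (fun p : ℝ × ℝ => (Γ p.2).g.mat i j) (univ ×ˢ U) :=
    fun i j => (hΓ.rot i j).comp contDiffOn_snd hsnd
  constructor
  · refine (hΓ.pos.comp contDiffOn_snd hsnd).add (hu.smul (contDiffOn_euclidean.2 fun i => ?_))
    exact ContDiffOn.sum (s := Finset.univ) fun j _ => (hm i j).mul contDiffOn_const
  · intro i j
    exact ContDiffOn.sum (s := Finset.univ) fun c _ => (hm i c).mul
      ((contDiff_rotPath ![ξ 3, ξ 4, ξ 5] c j).comp_contDiffOn hu)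
  · exact (hΓ.κ.comp contDiffOn_snd hsnd).add (hu.smul contDiffOn_const)
  · exact (hΓ.σ.comp contDiffOn_snd hsnd).mul (hu.mul contDiffOn_const).exp
  · exact fun i => ((hΓ.lam i).comp contDiffOn_snd hsnd).add (hu.mul contDiffOn_const)

variable (Γ φ)

theorem hasDerivAt_mul_const_zero (c : ℝ) : HasDerivAt (fun q : ℝ => q * c) c 0 := by
  simpa using (hasDerivAt_id (0 : ℝ)).mul_const c

theorem partialFst_perturb_κ :
    partialFst (fun t r => (perturb Γ φ k s m ξ t r).κ) 0 r = φ r • k :=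
  (((hasDerivAt_mul_const_zero (φ r)).smul_const k).const_add ((Γ r).κ)).deriv

theorem partialFst_perturb_σ :
    partialFst (fun t r => ((perturb Γ φ k s m ξ t r).σ : ℝ)) 0 r = φ r * (((Γ r).σ : ℝ) * s) := by
  refine ((((hasDerivAt_mul_const_zero (φ r)).mul_const s).exp).const_mul
    ((Γ r).σ : ℝ)).deriv.trans ?_
  simp; ring

theorem partialFst_perturb_lam (i : Fin 6) :
    partialFst (fun t r => (perturb Γ φ k s m ξ t r).lam i) 0 r = φ r * m i :=
  (((hasDerivAt_mul_const_zero (φ r)).mul_const (m i)).const_add ((Γ r).lam i)).deriv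

theorem coframeAlong_perturb :
    coframeAlong (fun q => (perturb Γ φ k s m ξ q r).g) 0 = fun i => φ r * ξ i := by
  set g : ℝ → SE3 := fun q => (perturb Γ φ k s m ξ q r).g with hg
  have h0 : (g 0).mat = (Γ r).g.mat := by simp [hg, perturb_zero]
  have hpos : deriv (fun q => (g q).pos) 0 =
      φ r • WithLp.toLp 2 ((Γ r).g.mat *ᵥ ![ξ 0, ξ 1, ξ 2]) :=
    (((hasDerivAt_mul_const_zero (φ r)).smul_const _).const_add _).deriv
  have hp : posForm g 0 = φ r • ![ξ 0, ξ 1, ξ 2] := by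
    rw [posForm, hpos, h0, WithLp.ofLp_smul, Matrix.mulVec_smul, Matrix.mulVec_mulVec,
      SE3.transpose_mul_mat, Matrix.one_mulVec]
  have hrot : rotVel g 0 = (Γ r).g.mat *
      (φ r • !![0, -ξ 5, ξ 4; ξ 5, 0, -ξ 3; -ξ 4, ξ 3, 0] : M3) := by
    ext i j
    have h1 : ∀ a b, HasDerivAt (fun q => (rotPath ![ξ 3, ξ 4, ξ 5] (q * φ r) : M3) a b)
        ((φ r • !![0, -ξ 5, ξ 4; ξ 5, 0, -ξ 3; -ξ 4, ξ 3, 0] : M3) a b) 0 := fun a b => by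
      have h2 := hasDerivAt_rotPath ![ξ 3, ξ 4, ξ 5] a b
      exact (HasDerivAt.comp_of_eq (0 : ℝ) h2 (hasDerivAt_mul_const_zero (φ r))
        (zero_mul _).symm).congr_deriv (mul_comm _ _)
    have h3 := hasDerivAt_mul_apply (A := fun _ => (Γ r).g.mat) (A' := 0)
      (fun a b => hasDerivAt_const (0 : ℝ) ((Γ r).g.mat a b)) h1 i j
    rw [zero_mul, zero_add] at h3
    exact h3.deriv
  have hr : rotForm g 0 = φ r • !![0, -ξ 5, ξ 4; ξ 5, 0, -ξ 3; -ξ 4, ξ 3, 0] := by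
    rw [rotForm, hrot, h0, ← Matrix.mul_assoc, SE3.transpose_mul_mat, Matrix.one_mul]
  rw [coframeAlong_eq, hp, hr]
  ext i
  fin_cases i <;> rfl

end perturb

theorem isPerturbation_perturb {L a b : ℝ} {Γ : ℝ → Z} {φ : ℝ → ℝ} (hΓ : SmoothOn Γ (Ioo 0 L))
    (hφ : ContDiff ℝ ∞ φ) (k : E2) (s : ℝ) (m ξ : Fin 6 → ℝ)
    (h : (φ a = 0 ∧ φ b = 0) ∨ ∀ i, i ≠ 5 → ξ i = 0) :
    IsPerturbation L a b Γ (perturb Γ φ k s m ξ) := by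
  have key : ∀ t r, (φ r = 0 ∨ ∀ i, i ≠ 5 → ξ i = 0) →
      (perturb Γ φ k s m ξ t r).g.pos = (Γ r).g.pos ∧
        (perturb Γ φ k s m ξ t r).g.dir = (Γ r).g.dir := by
    rintro t r (h | h)
    · rw [perturb_eq_of_mul_eq_zero _ _ _ _ _ _ _ _ (by rw [h, mul_zero])]
      exact ⟨rfl, rfl⟩
    · constructor
      · have hz : ![ξ 0, ξ 1, ξ 2] = 0 := by
          ext i; fin_cases i
          exacts [h 0 (by decide), h 1 (by decide), h 2 (by decide)]
        simp [perturb, hz]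
      · ext i
        rw [SE3.dir_apply, SE3.dir_apply, perturb_mat, Matrix.mul_apply]
        simp only [rotPath_apply_two (z := ![ξ 3, ξ 4, ξ 5]) (h 3 (by decide)) (h 4 (by decide))]
        rw [← Matrix.mul_apply, Matrix.mul_one]
  refine ⟨smoothOn_perturb k s m ξ hΓ hφ, fun r _ => by rw [perturb_zero], fun t => key t a ?_,
    fun t => key t b ?_⟩
  exacts [h.imp_left And.left, h.imp_left And.right]

theorem eulerLagrange_smul (β : ℝ) (Γ : ℝ → Z) (c : ℝ) (k : E2) (s : ℝ) (m ξ : Fin 6 → ℝ) (r : ℝ) :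
    eulerLagrange β Γ (c • k) (c * s) (fun i => c * m i) (fun i => c * ξ i) r =
      c * eulerLagrange β Γ k s m ξ r := by
  simp only [eulerLagrange, mul_add, Finset.mul_sum, PiLp.smul_apply, smul_eq_mul]
  refine congrArg₂ _ (congrArg₂ _ (congrArg₂ _ ?_ ?_) ?_) ?_
  · ring
  · ring
  · exact Finset.sum_congr rfl fun i _ => by ring
  · exact Finset.sum_congr rfl fun i _ => by ring

/-- The general first-variation formula and stationarity give two values of one derivative. The
boundary term is kept because the second alternative in `h` allows φ to be nonzero at the ends. -/
theorem integral_perturb {β L a b : ℝ} (hβ : 0 < β) (ha : 0 < a) (hab : a < b) (hb : b < L)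
    {Γ : ℝ → Z} (hΓ : IsStationaryZ β L Γ) {φ : ℝ → ℝ} (hφ : ContDiff ℝ ∞ φ)
    (k : E2) (s : ℝ) (m ξ : Fin 6 → ℝ) (h : (φ a = 0 ∧ φ b = 0) ∨ ∀ i, i ≠ 5 → ξ i = 0) :
    (∫ r in a..b, φ r * eulerLagrange β Γ k (((Γ r).σ : ℝ) * s) m ξ r) +
      (∑ i, (Γ b).lam i * (φ b * ξ i) - ∑ i, (Γ a).lam i * (φ a * ξ i)) = 0 := by
  have h1 := hΓ.stationary a b ha hab hb _ (isPerturbation_perturb hΓ.smooth hφ k s m ξ h)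
  have h2 := hasDerivAt_integral_psi hβ ha hab.le hb (smoothOn_perturb k s m ξ hΓ.smooth hφ) 0
  simp only [partialFst_perturb_κ, partialFst_perturb_lam, partialFst_perturb_σ,
    coframeAlong_perturb, perturb_zero, eulerLagrange_smul] at h2
  exact h2.unique h1

/-- A curve regarded as a constant family. -/
theorem SmoothOn.uncurry_const {U : Set ℝ} {Γ : ℝ → Z} (h : SmoothOn Γ U) :
    SmoothOn (Function.uncurry fun _ : ℝ => Γ) (univ ×ˢ U) := by
  have hsnd : MapsTo (Prod.snd : ℝ × ℝ → ℝ) (univ ×ˢ U) U := fun p hp => hp.2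
  exact ⟨h.pos.comp contDiffOn_snd hsnd, fun i j => (h.rot i j).comp contDiffOn_snd hsnd,
    h.κ.comp contDiffOn_snd hsnd, h.σ.comp contDiffOn_snd hsnd,
    fun i => (h.lam i).comp contDiffOn_snd hsnd⟩

section Smooth

variable {U : Set ℝ} {Γ : ℝ → Z}

theorem SmoothOn.coframeAlong (h : SmoothOn Γ U) (hU : IsOpen U) (i : Fin 6) :
    ContDiffOn ℝ ∞ (fun r => coframeAlong (fun q => (Γ q).g) r i) U :=
  contDiffOn_slice_snd (t := 0) ((h.uncurry_const.smoothFamily (isOpen_univ.prod hU)).contDiffOn_snd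
    i) fun _ hr => ⟨trivial, hr⟩

theorem SmoothOn.normCurv (h : SmoothOn Γ U) {β : ℝ} (hβ : 0 < β) :
    ContDiffOn ℝ ∞ (normCurv β Γ) U := by
  have h1 : ∀ r, 0 < ‖(Γ r).κ‖ ^ 2 + β ^ 2 := fun r => by positivity
  have h2 : ContDiffOn ℝ ∞ (fun r => ‖(Γ r).κ‖ ^ 2) U := h.κ.norm_sq ℝ
  exact ((h2.add contDiffOn_const).sqrt fun r _ => (h1 r).ne').inv
    (fun r _ => (Real.sqrt_pos.2 (h1 r)).ne') |>.smul h.κ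

theorem SmoothOn.theta (h : SmoothOn Γ U) (hU : IsOpen U) (i : Fin 6) :
    ContDiffOn ℝ ∞ (fun r => theta Γ r i) U := by
  have hκ := contDiffOn_euclidean.1 h.κ
  have hc := h.coframeAlong hU
  fin_cases i
  · exact (hc 0).congr fun r _ => theta_zero Γ r
  · exact (hc 1).congr fun r _ => theta_one Γ r
  · exact ((hc 2).sub h.σ).congr fun r _ => theta_two Γ r
  · exact ((hc 3).add ((hκ 1).mul h.σ)).congr fun r _ => theta_three Γ r
  · exact ((hc 4).sub ((hκ 0).mul h.σ)).congr fun r _ => theta_four Γ r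
  · exact (hc 5).congr fun r _ => theta_five Γ r

theorem SmoothOn.continuousOn_eulerLagrange (h : SmoothOn Γ U) (hU : IsOpen U) {β : ℝ} (hβ : 0 < β)
    (k : E2) (s : ℝ) (m ξ : Fin 6 → ℝ) :
    ContinuousOn (fun r => eulerLagrange β Γ k (((Γ r).σ : ℝ) * s) m ξ r) U := by
  have hκ := fun i => (contDiffOn_euclidean.1 h.κ i).continuousOn
  have hw := fun i => (contDiffOn_euclidean.1 (h.normCurv hβ) i).continuousOn
  have hc := fun i => (h.coframeAlong hU i).continuousOn
  have hσ := h.σ.continuousOn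
  have hl := fun i => (h.lam i).continuousOn
  have hE : ContinuousOn (fun r => √(‖(Γ r).κ‖ ^ 2 + β ^ 2)) U :=
    ((h.κ.continuousOn.norm.pow 2).add continuousOn_const).sqrt
  have hm : ∀ i, ContinuousOn
      (fun r => momentumRate (CuspGeo.coframeAlong (fun q => (Γ q).g) r) (Γ r).lam i) U := by
    intro i
    fin_cases i
    · exact ((hc 5).mul (hl 1)).sub ((hc 4).mul (hl 2))
    · exact ((hc 3).mul (hl 2)).sub ((hc 5).mul (hl 0))
    · exact ((hc 4).mul (hl 0)).sub ((hc 3).mul (hl 1))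
    · exact (((hc 5).mul (hl 4)).sub ((hc 4).mul (hl 5))).sub
        (((hc 1).mul (hl 2)).sub ((hc 2).mul (hl 1)))
    · exact (((hc 3).mul (hl 5)).sub ((hc 5).mul (hl 3))).sub
        (((hc 2).mul (hl 0)).sub ((hc 0).mul (hl 2)))
    · exact (((hc 4).mul (hl 3)).sub ((hc 3).mul (hl 4))).sub
        (((hc 0).mul (hl 1)).sub ((hc 1).mul (hl 0)))
  have hd := fun i => (h.lam i).continuousOn_deriv_of_isOpen hU (by simp)
  refine ContinuousOn.add (ContinuousOn.add (ContinuousOn.add ?_ ?_) ?_) ?_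
  · exact hσ.mul ((((hw 0).sub (hl 4)).mul continuousOn_const).add
      (((hw 1).add (hl 3)).mul continuousOn_const))
  · exact (((hE.sub (hl 2)).add ((hl 3).mul (hκ 1))).sub ((hl 4).mul (hκ 0))).mul
      (hσ.mul continuousOn_const)
  · exact continuousOn_finsetSum _ fun i _ =>
      (h.theta hU i).continuousOn.mul continuousOn_const
  · exact continuousOn_finsetSum _ fun i _ => ((hm i).sub (hd i)).mul continuousOn_const

end Smooth

/-! ### Necessity of the Euler-Lagrange equations and of λ₆ = 0. -/

namespace IsStationaryZ

variable {β L : ℝ} {Γ : ℝ → Z}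

theorem eulerLagrange_eq_zero (hβ : 0 < β) (hΓ : IsStationaryZ β L Γ) {r : ℝ} (hr : r ∈ Ioo 0 L)
    (k : E2) (s : ℝ) (m ξ : Fin 6 → ℝ) : eulerLagrange β Γ k s m ξ r = 0 := by
  obtain ⟨a, ha, har⟩ := exists_between hr.1
  obtain ⟨b, hrb, hb⟩ := exists_between hr.2
  have hσ : ((Γ r).σ : ℝ) ≠ 0 := (Γ r).σ.2.ne'
  -- Dividing `s` by the speed at the chosen point r compensates the factor `σ` in the test
  -- variation, so exactly `s` appears at r.
  have hz := eqOn_zero_of_integral_smul_eq_zero (a := a) (b := b)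
    (f := fun q => eulerLagrange β Γ k (((Γ q).σ : ℝ) * (s / ((Γ r).σ : ℝ))) m ξ q)
    ((hΓ.smooth.continuousOn_eulerLagrange isOpen_Ioo hβ k _ m ξ).mono
      fun q hq => ⟨ha.trans hq.1, hq.2.trans hb⟩) (fun φ hφ _ hs => ?_) r ⟨har, hrb⟩
  · rwa [mul_div_cancel₀ _ hσ] at hz
  · have hzero : ∀ q, q ∉ Ioo a b → φ q = 0 := fun q hq =>
      image_eq_zero_of_notMem_tsupport fun h => hq (hs h)
    have h0a := hzero a (by simp)
    have h0b := hzero b (by simp)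
    have := integral_perturb hβ ha (har.trans hrb) hb hΓ hφ k (s / ((Γ r).σ : ℝ)) m ξ
      (Or.inl ⟨h0a, h0b⟩)
    simpa [h0a, h0b] using this

theorem lam_five (hβ : 0 < β) (hΓ : IsStationaryZ β L Γ) {r : ℝ} (hr : r ∈ Ioo 0 L) :
    (Γ r).lam 5 = 0 := by
  obtain ⟨a, ha, har⟩ := exists_between hr.1
  -- A z-rotation that vanishes at a but not at r: the integral is zero by the Euler-Lagrange
  -- equations, leaving `lam 5` at r times r - a.
  have h := integral_perturb hβ ha har hr.2 hΓ (φ := fun q => q - a) (by fun_prop) 0 0 0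
    (Pi.single 5 1) (Or.inr fun i hi => by simp [hi])
  have hz : ∫ q in a..r, (q - a) * eulerLagrange β Γ 0 (((Γ q).σ : ℝ) * 0) 0 (Pi.single 5 1) q = 0 :=
    (intervalIntegral.integral_congr (g := fun _ => (0 : ℝ)) fun q hq => by
      rw [uIcc_of_le har.le] at hq
      simp only [hΓ.eulerLagrange_eq_zero hβ ⟨ha.trans_le hq.1, hq.2.trans_lt hr.2⟩, mul_zero]).trans
      intervalIntegral.integral_zero
  rw [hz] at h
  simpa [Pi.single_apply, sub_eq_zero, har.ne'] using h

end IsStationaryZ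

/-! ### Consequences of the Euler-Lagrange equations -/

/-- The variations are independent, so each coefficient vanishes separately; σ > 0 is cancelled in
the κ-equations. -/
theorem eulerLagrange_eq_zero_iff {β : ℝ} {Γ : ℝ → Z} {r : ℝ} :
    (∀ k s m ξ, eulerLagrange β Γ k s m ξ r = 0) ↔
      (normCurv β Γ r 0 = (Γ r).lam 4 ∧ normCurv β Γ r 1 = -(Γ r).lam 3) ∧
      (Γ r).lam 2 = √(‖(Γ r).κ‖ ^ 2 + β ^ 2) + (Γ r).lam 3 * (Γ r).κ 1 - (Γ r).lam 4 * (Γ r).κ 0 ∧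
      (∀ i, theta Γ r i = 0) ∧
      ∀ i, deriv (fun q => (Γ q).lam i) r =
        momentumRate (coframeAlong (fun q => (Γ q).g) r) (Γ r).lam i := by
  have hσ : ((Γ r).σ : ℝ) ≠ 0 := (Γ r).σ.2.ne'
  constructor
  · intro h
    refine ⟨⟨?_, ?_⟩, ?_, fun i => ?_, fun i => ?_⟩
    · have := h (EuclideanSpace.single 0 1) 0 0 0
      simp [eulerLagrange, hσ] at this
      linarith
    · have := h (EuclideanSpace.single 1 1) 0 0 0
      simp [eulerLagrange, hσ] at this
      linarith
    · have := h 0 1 0 0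
      simp [eulerLagrange] at this
      linarith
    · simpa [eulerLagrange, Pi.single_apply] using h 0 0 (Pi.single i 1) 0
    · have := h 0 0 0 (Pi.single i 1)
      simp [eulerLagrange, Pi.single_apply] at this
      linarith
  · rintro ⟨⟨h0, h1⟩, h2, h3, h4⟩ k s m ξ
    simp only [eulerLagrange, h0, h1, h2, h3, h4]
    simp
    ring_nf
    simp

/-! ### Geometry of the moving frame and its curvature. -/

section Frame

variable {g : ℝ → SE3} {r : ℝ}

theorem hasDerivAt_pos_of_posForm (h : posForm g r = ![0, 0, 1]) :
    deriv (fun q => (g q).pos) r = (g r).dir := by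
  have h1 : WithLp.ofLp (deriv (fun q => (g q).pos) r) = (g r).mat *ᵥ posForm g r := by
    rw [posForm, Matrix.mulVec_mulVec, SE3.mat_mul_transpose, Matrix.one_mulVec]
  ext k
  rw [SE3.dir_apply, h1, h]
  simp [Matrix.mulVec, dotProduct, Fin.sum_univ_three]

theorem rotVel_apply (k b : Fin 3) :
    rotVel g r k b = ∑ c, (g r).mat k c * rotForm g r c b := by
  rw [rotVel_eq_mul, Matrix.mul_apply]

theorem E3.norm_sq (v : E3) : ‖v‖ ^ 2 = v 0 ^ 2 + v 1 ^ 2 + v 2 ^ 2 := by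
  simp [EuclideanSpace.norm_sq_eq, Fin.sum_univ_three]

theorem SE3.norm_dir (g : SE3) : ‖g.dir‖ = 1 := by
  have h : ‖g.dir‖ ^ 2 = 1 := by
    rw [E3.norm_sq]
    simp only [SE3.dir_apply]
    have := g.sum_mat_mul_mat 2 2
    simp [Fin.sum_univ_three] at this
    linarith
  exact (pow_eq_one_iff_of_nonneg (norm_nonneg _) (by norm_num)).1 h

theorem hasDerivAt_dir (h : ∀ i j, DifferentiableAt ℝ (fun q => (g q).mat i j) r) :
    HasDerivAt (fun q => (g q).dir) (WithLp.toLp 2 fun k => rotVel g r k 2) r := by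
  have h1 : HasDerivAt (fun q (k : Fin 3) => (g q).mat k 2) (fun k => rotVel g r k 2) r :=
    hasDerivAt_pi.2 fun k => (h k 2).hasDerivAt
  have h2 := (PiLp.continuousLinearEquiv 2 ℝ fun _ : Fin 3 => ℝ).symm.hasFDerivAt.comp_hasDerivAt r h1
  refine h2.congr_of_eventuallyEq (Eventually.of_forall fun q => ?_)
  ext k
  exact SE3.dir_apply _ k

theorem rotVel_apply_two (h : ∀ i j, DifferentiableAt ℝ (fun q => (g q).mat i j) r) (k : Fin 3) :
    rotVel g r k 2 = (g r).mat k 0 * coframeAlong g r 4 - (g r).mat k 1 * coframeAlong g r 3 := by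
  have h1 : rotForm g r 1 2 = -rotForm g r 2 1 := rotForm_antisymm h 1 2
  have h2 : rotForm g r 2 2 = 0 := by linarith [rotForm_antisymm h 2 2]
  rw [rotVel_apply, Fin.sum_univ_three, h1, h2]
  change _ = (g r).mat k 0 * rotForm g r 0 2 - (g r).mat k 1 * rotForm g r 2 1
  ring

theorem norm_sq_dir_deriv (h : ∀ i j, DifferentiableAt ℝ (fun q => (g q).mat i j) r) :
    ‖(WithLp.toLp 2 fun k => rotVel g r k 2 : E3)‖ ^ 2 =
      coframeAlong g r 4 ^ 2 + coframeAlong g r 3 ^ 2 := by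
  have h00 := (g r).sum_mat_mul_mat 0 0
  have h01 := (g r).sum_mat_mul_mat 0 1
  have h11 := (g r).sum_mat_mul_mat 1 1
  simp [Fin.sum_univ_three] at h00 h01 h11
  rw [E3.norm_sq]
  simp only [rotVel_apply_two h]
  linear_combination coframeAlong g r 4 ^ 2 * h00 -
    2 * coframeAlong g r 4 * coframeAlong g r 3 * h01 + coframeAlong g r 3 ^ 2 * h11

end Frame

theorem curvature_of_unit_speed {x : ℝ → E3} {U : Set ℝ} (hU : IsOpen U)
    (h : ∀ s ∈ U, ‖deriv x s‖ = 1) {s : ℝ} (hs : s ∈ U) :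
    curvature x s = ‖deriv (deriv x) s‖ := by
  have : unitTangent x =ᶠ[𝓝 s] deriv x := by
    filter_upwards [hU.mem_nhds hs] with q hq
    simp [unitTangent, h q hq]
  rw [curvature, this.deriv_eq, h s hs, div_one]

/-- Horizontality and σ = 1 make R e_z the unit tangent. Its derivative has the orthonormal
coordinates (ω⁵, -ω⁴, 0), which are (κ₁, κ₂, 0). -/
theorem curvature_eq_of_theta {Γ : ℝ → Z} {U : Set ℝ} (hU : IsOpen U) (hΓ : SmoothOn Γ U)
    (hσ : ∀ s ∈ U, ((Γ s).σ : ℝ) = 1) (hθ : ∀ s ∈ U, ∀ i, theta Γ s i = 0) {s : ℝ} (hs : s ∈ U) :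
    curvature (fun q => (Γ q).g.pos) s = ‖(Γ s).κ‖ := by
  have hpos : ∀ q ∈ U, deriv (fun q => (Γ q).g.pos) q = (Γ q).g.dir := fun q hq =>
    hasDerivAt_pos_of_posForm (g := fun q => (Γ q).g) <| by
      ext a
      fin_cases a
      · exact hθ q hq 0
      · exact hθ q hq 1
      · exact (sub_eq_zero.1 ((theta_two Γ q).symm.trans (hθ q hq 2))).trans (hσ q hq)
  have hd : ∀ i j, DifferentiableAt ℝ (fun q => (Γ q).g.mat i j) s := fun i j =>
    ((hΓ.rot i j).contDiffAt (hU.mem_nhds hs)).differentiableAt (by simp)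
  rw [curvature_of_unit_speed hU (fun q hq => by rw [hpos q hq, SE3.norm_dir]) hs,
    EventuallyEq.deriv_eq (f := fun q => (Γ q).g.dir) (eventually_of_mem (hU.mem_nhds hs) hpos),
    (hasDerivAt_dir (g := fun q => (Γ q).g) hd).deriv]
  refine (pow_left_inj₀ (norm_nonneg _) (norm_nonneg _) two_ne_zero).1 ?_
  have h3 := (theta_three Γ s).symm.trans (hθ s hs 3)
  have h4 := (theta_four Γ s).symm.trans (hθ s hs 4)
  rw [hσ s hs, mul_one] at h3 h4
  rw [norm_sq_dir_deriv (g := fun q => (Γ q).g) hd, E2.norm_sq, eq_neg_of_add_eq_zero_left h3,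
    sub_eq_zero.1 h4]
  ring

/-! ### The linear equation for the normalized curvature. -/

section LinearODE

variable {E : Type*} [NormedAddCommGroup E] [NormedSpace ℝ E]

/-- Solutions of `w'' = β² w` on `(0, L)` are combinations of `cosh` and `sinh`. -/
theorem exists_cosh_sinh {β L : ℝ} (hβ : 0 < β) (hL : 0 < L) {w v : ℝ → E}
    (hw : ∀ s ∈ Ioo 0 L, HasDerivAt w (v s) s)
    (hv : ∀ s ∈ Ioo 0 L, HasDerivAt v (β ^ 2 • w s) s) :
    ∃ w₀ v₀ : E, ∀ s ∈ Ioo 0 L,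
      w s = Real.cosh (β * s) • w₀ + (Real.sinh (β * s) / β) • v₀ ∧
      v s = (β * Real.sinh (β * s)) • w₀ + Real.cosh (β * s) • v₀ := by
  have hlin : ∀ s : ℝ, HasDerivAt (fun q => β * q) β s := fun s => by
    simpa using (hasDerivAt_id s).const_mul β
  have hc : ∀ s, HasDerivAt (fun q => Real.cosh (β * q)) (Real.sinh (β * s) * β) s :=
    fun s => (hlin s).cosh
  have hs : ∀ s, HasDerivAt (fun q => Real.sinh (β * q)) (Real.cosh (β * s) * β) s :=
    fun s => (hlin s).sinh
  -- `hA` and `hB` transport the data at s back to 0 by the inverse flow; the results are constants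
  -- of motion, and no value at 0 is needed to define them.
  have hA : ∀ s ∈ Ioo 0 L, HasDerivAt
      (fun q => Real.cosh (β * q) • w q - (Real.sinh (β * q) / β) • v q) 0 s := fun s h => by
    refine (((hc s).fun_smul (hw s h)).fun_sub (((hs s).div_const β).fun_smul (hv s h))).congr_deriv ?_
    have : Real.sinh (β * s) / β * β ^ 2 = Real.sinh (β * s) * β := by field_simp
    rw [smul_smul, this, mul_div_assoc, div_self hβ.ne', mul_one]
    abel
  have hB : ∀ s ∈ Ioo 0 L, HasDerivAt
      (fun q => Real.cosh (β * q) • v q - (β * Real.sinh (β * q)) • w q) 0 s := fun s h => by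
    refine (((hc s).fun_smul (hv s h)).fun_sub
      (((hs s).const_mul β).fun_smul (hw s h))).congr_deriv ?_
    module
  have hconst : ∀ f : ℝ → E, (∀ s ∈ Ioo 0 L, HasDerivAt f 0 s) →
      ∀ s ∈ Ioo 0 L, f s = f (L / 2) := fun f hf s h =>
    isOpen_Ioo.is_const_of_deriv_eq_zero isPreconnected_Ioo
      (fun q hq => (hf q hq).differentiableAt.differentiableWithinAt) (fun q hq => (hf q hq).deriv) h
      ⟨by linarith, by linarith⟩
  obtain ⟨w₀, hw₀⟩ : ∃ w₀, ∀ s ∈ Ioo 0 L,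
      Real.cosh (β * s) • w s - (Real.sinh (β * s) / β) • v s = w₀ := ⟨_, hconst _ hA⟩
  obtain ⟨v₀, hv₀⟩ : ∃ v₀, ∀ s ∈ Ioo 0 L,
      Real.cosh (β * s) • v s - (β * Real.sinh (β * s)) • w s = v₀ := ⟨_, hconst _ hB⟩
  refine ⟨w₀, v₀, fun s h => ?_⟩
  rw [← hw₀ s h, ← hv₀ s h]
  have h1 := Real.cosh_sq (β * s)
  have key : ∀ x y : E, ∀ c d : ℝ, c = 1 → d = 0 → x = c • x + d • y := by
    rintro x y c d rfl rfl; simp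
  constructor
  · refine (key (w s) (v s) (Real.cosh (β * s) ^ 2 - Real.sinh (β * s) / β * (β * Real.sinh (β * s)))
      0 ?_ rfl).trans ?_
    · field_simp; linarith
    · module
  · refine (key (v s) (w s) (Real.cosh (β * s) ^ 2 - Real.sinh (β * s) / β * (β * Real.sinh (β * s)))
      0 ?_ rfl).trans ?_
    · field_simp; linarith
    · module

end LinearODE

/-! ### Multipliers, the equation for w, and conservation laws. -/

namespace IsStationaryZ

variable {β L : ℝ} {Γ : ℝ → Z}

theorem theta_eq_zero (hβ : 0 < β) (hΓ : IsStationaryZ β L Γ) {s : ℝ} (hs : s ∈ Ioo 0 L)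
    (i : Fin 6) : theta Γ s i = 0 :=
  (eulerLagrange_eq_zero_iff.1 (hΓ.eulerLagrange_eq_zero hβ hs)).2.2.1 i

theorem normCurv_zero (hβ : 0 < β) (hΓ : IsStationaryZ β L Γ) {s : ℝ} (hs : s ∈ Ioo 0 L) :
    normCurv β Γ s 0 = (Γ s).lam 4 :=
  (eulerLagrange_eq_zero_iff.1 (hΓ.eulerLagrange_eq_zero hβ hs)).1.1

theorem normCurv_one (hβ : 0 < β) (hΓ : IsStationaryZ β L Γ) {s : ℝ} (hs : s ∈ Ioo 0 L) :
    normCurv β Γ s 1 = -(Γ s).lam 3 :=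
  (eulerLagrange_eq_zero_iff.1 (hΓ.eulerLagrange_eq_zero hβ hs)).1.2

theorem lam_two (hβ : 0 < β) (hΓ : IsStationaryZ β L Γ) {s : ℝ} (hs : s ∈ Ioo 0 L) :
    (Γ s).lam 2 = β ^ 2 / √(‖(Γ s).κ‖ ^ 2 + β ^ 2) := by
  have h := (eulerLagrange_eq_zero_iff.1 (hΓ.eulerLagrange_eq_zero hβ hs)).2.1
  have h3 : (Γ s).lam 3 = -normCurv β Γ s 1 := by rw [hΓ.normCurv_one hβ hs, neg_neg]
  have hpos : 0 < ‖(Γ s).κ‖ ^ 2 + β ^ 2 := by positivity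
  have hE := (Real.sqrt_pos.2 hpos).ne'
  have hsq := Real.sq_sqrt hpos.le
  rw [h, h3, ← hΓ.normCurv_zero hβ hs, normCurv_apply, normCurv_apply, eq_div_iff hE]
  rw [E2.norm_sq] at *
  field_simp
  linear_combination hsq

theorem lam_two_eq_sqrt (hβ : 0 < β) (hΓ : IsStationaryZ β L Γ) {s : ℝ} (hs : s ∈ Ioo 0 L) :
    (Γ s).lam 2 = β * √(1 - ‖normCurv β Γ s‖ ^ 2) := by
  have hpos : 0 < ‖(Γ s).κ‖ ^ 2 + β ^ 2 := by positivity
  have hE := Real.sqrt_pos.2 hpos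
  have hsq := Real.sq_sqrt hpos.le
  have h : 1 - ‖normCurv β Γ s‖ ^ 2 = (β / √(‖(Γ s).κ‖ ^ 2 + β ^ 2)) ^ 2 := by
    rw [normCurv, norm_smul, norm_inv, Real.norm_of_nonneg hE.le]
    field_simp
    linear_combination hsq
  rw [h, Real.sqrt_sq (by positivity), hΓ.lam_two hβ hs]
  ring

/-- Vanishing θ and unit speed fix the body velocity as (0, 0, 1, -κ₂, κ₁, 0); the coadjoint
equation is evaluated there, using λ₆ = 0. -/
theorem deriv_lam (hβ : 0 < β) (hΓ : IsStationaryZ β L Γ) (hσ : ∀ s ∈ Ioo 0 L, ((Γ s).σ : ℝ) = 1)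
    {s : ℝ} (hs : s ∈ Ioo 0 L) :
    deriv (fun q => (Γ q).lam 0) s = -((Γ s).κ 0 * (Γ s).lam 2) ∧
    deriv (fun q => (Γ q).lam 1) s = -((Γ s).κ 1 * (Γ s).lam 2) ∧
    deriv (fun q => (Γ q).lam 3) s = (Γ s).lam 1 ∧
    deriv (fun q => (Γ q).lam 4) s = -(Γ s).lam 0 := by
  have h := (eulerLagrange_eq_zero_iff.1 (hΓ.eulerLagrange_eq_zero hβ hs)).2.2.2
  have hθ := fun i => hΓ.theta_eq_zero hβ hs i
  have c0 := (theta_zero Γ s).symm.trans (hθ 0)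
  have c1 := (theta_one Γ s).symm.trans (hθ 1)
  have c2 := sub_eq_zero.1 ((theta_two Γ s).symm.trans (hθ 2))
  have c3 := eq_neg_of_add_eq_zero_left ((theta_three Γ s).symm.trans (hθ 3))
  have c4 := sub_eq_zero.1 ((theta_four Γ s).symm.trans (hθ 4))
  have c5 := (theta_five Γ s).symm.trans (hθ 5)
  have h5 := hΓ.lam_five hβ hs
  rw [hσ s hs] at c2 c3 c4
  refine ⟨(h 0).trans ((vec_zero ..).trans ?_), (h 1).trans ((vec_one ..).trans ?_),
    (h 3).trans ((vec_three ..).trans ?_), (h 4).trans ((vec_four ..).trans ?_)⟩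
  · rw [c4, c5]; ring
  · rw [c3, c5]; ring
  · rw [c1, c2, c4, c5, h5]; ring
  · rw [c0, c2, c3, c5, h5]; ring

theorem hasDerivAt_normCurv (hβ : 0 < β) (hΓ : IsStationaryZ β L Γ) {s : ℝ} (hs : s ∈ Ioo 0 L) :
    HasDerivAt (normCurv β Γ) (deriv (normCurv β Γ) s) s :=
  (((hΓ.smooth.normCurv hβ).contDiffAt (isOpen_Ioo.mem_nhds hs)).differentiableAt
    (by simp)).hasDerivAt

theorem hasDerivAt_lam (hΓ : IsStationaryZ β L Γ) {s : ℝ} (hs : s ∈ Ioo 0 L) (i : Fin 6) :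
    HasDerivAt (fun q => (Γ q).lam i) (deriv (fun q => (Γ q).lam i) s) s :=
  (((hΓ.smooth.lam i).contDiffAt (isOpen_Ioo.mem_nhds hs)).differentiableAt (by simp)).hasDerivAt

theorem lam_zero_one (hβ : 0 < β) (hΓ : IsStationaryZ β L Γ)
    (hσ : ∀ s ∈ Ioo 0 L, ((Γ s).σ : ℝ) = 1) {s : ℝ} (hs : s ∈ Ioo 0 L) :
    (Γ s).lam 0 = -deriv (normCurv β Γ) s 0 ∧ (Γ s).lam 1 = -deriv (normCurv β Γ) s 1 := by
  obtain ⟨-, -, h3, h4⟩ := hΓ.deriv_lam hβ hσ hs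
  have hw := hΓ.hasDerivAt_normCurv hβ hs
  have d0 := (hΓ.hasDerivAt_lam hs 4).unique <| (hasDerivAt_apply hw 0).congr_of_eventuallyEq <| by
    filter_upwards [isOpen_Ioo.mem_nhds hs] with q hq using (hΓ.normCurv_zero hβ hq).symm
  have d1 := (hΓ.hasDerivAt_lam hs 3).unique <|
    (hasDerivAt_apply hw 1).fun_neg.congr_of_eventuallyEq <| by
      filter_upwards [isOpen_Ioo.mem_nhds hs] with q hq
      rw [hΓ.normCurv_one hβ hq, neg_neg]
  exact ⟨by linarith, by linarith⟩

/-- Since w' = -(λ₁, λ₂), the second derivative is λ₃(κ₁, κ₂), and λ₃ = β²/E turns κ/E back into w.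
-/
theorem hasDerivAt_deriv_normCurv (hβ : 0 < β) (hΓ : IsStationaryZ β L Γ)
    (hσ : ∀ s ∈ Ioo 0 L, ((Γ s).σ : ℝ) = 1) {s : ℝ} (hs : s ∈ Ioo 0 L) :
    HasDerivAt (deriv (normCurv β Γ)) (β ^ 2 • normCurv β Γ s) s := by
  have hd : HasDerivAt (deriv (normCurv β Γ)) (deriv (deriv (normCurv β Γ)) s) s :=
    ((((hΓ.smooth.normCurv hβ).deriv_of_isOpen isOpen_Ioo (m := ∞) le_rfl).contDiffAt
      (isOpen_Ioo.mem_nhds hs)).differentiableAt (by simp)).hasDerivAt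
  refine hd.congr_deriv ?_
  obtain ⟨h0, h1, -, -⟩ := hΓ.deriv_lam hβ hσ hs
  have d0 := (hΓ.hasDerivAt_lam hs 0).unique <|
    (hasDerivAt_apply hd 0).fun_neg.congr_of_eventuallyEq <| by
      filter_upwards [isOpen_Ioo.mem_nhds hs] with q hq using (hΓ.lam_zero_one hβ hσ hq).1
  have d1 := (hΓ.hasDerivAt_lam hs 1).unique <|
    (hasDerivAt_apply hd 1).fun_neg.congr_of_eventuallyEq <| by
      filter_upwards [isOpen_Ioo.mem_nhds hs] with q hq using (hΓ.lam_zero_one hβ hσ hq).2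
  rw [h0, hΓ.lam_two hβ hs] at d0
  rw [h1, hΓ.lam_two hβ hs] at d1
  ext k
  rw [PiLp.smul_apply, smul_eq_mul, normCurv_apply]
  fin_cases k
  · exact (neg_injective d0).symm.trans (by simp only [Fin.zero_eta]; ring)
  · exact (neg_injective d1).symm.trans (by simp only [Fin.mk_one]; ring)

theorem conservation (hβ : 0 < β) (hΓ : IsStationaryZ β L Γ)
    (hσ : ∀ s ∈ Ioo 0 L, ((Γ s).σ : ℝ) = 1) {s : ℝ} (hs : s ∈ Ioo 0 L) :
    (Γ s).lam 0 ^ 2 + (Γ s).lam 1 ^ 2 + (Γ s).lam 2 ^ 2 =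
        ‖deriv (normCurv β Γ) s‖ ^ 2 + β ^ 2 * (1 - ‖normCurv β Γ s‖ ^ 2) ∧
      (β ^ 2)⁻¹ * (Γ s).lam 2 ^ 2 + (Γ s).lam 3 ^ 2 + (Γ s).lam 4 ^ 2 = 1 := by
  obtain ⟨h0, h1⟩ := hΓ.lam_zero_one hβ hσ hs
  have h3 : (Γ s).lam 3 = -normCurv β Γ s 1 := by rw [hΓ.normCurv_one hβ hs, neg_neg]
  have h2 : (Γ s).lam 2 ^ 2 = β ^ 2 * (1 - ‖normCurv β Γ s‖ ^ 2) := by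
    -- If this were negative, `Real.sqrt` would return 0, contradicting λ₃ = β²/E > 0.
    have hnn : 0 ≤ 1 - ‖normCurv β Γ s‖ ^ 2 := by
      by_contra hneg
      have h := hΓ.lam_two_eq_sqrt hβ hs
      rw [Real.sqrt_eq_zero_of_nonpos (not_le.1 hneg).le, mul_zero, hΓ.lam_two hβ hs] at h
      exact absurd h (by positivity)
    rw [hΓ.lam_two_eq_sqrt hβ hs, mul_pow, Real.sq_sqrt hnn]
  constructor
  · rw [h2, h0, h1, E2.norm_sq (deriv _ _)]
    ring
  · rw [h2, h3, ← hΓ.normCurv_zero hβ hs, E2.norm_sq, inv_mul_cancel_left₀ (by positivity)]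
    ring

theorem exists_limits (hβ : 0 < β) (hL : 0 < L) (hΓ : IsStationaryZ β L Γ)
    (hσ : ∀ s ∈ Ioo 0 L, ((Γ s).σ : ℝ) = 1) :
    ∃ w₀ v₀ : E2, Tendsto (normCurv β Γ) (𝓝[>] 0) (𝓝 w₀) ∧
      Tendsto (deriv (normCurv β Γ)) (𝓝[>] 0) (𝓝 v₀) ∧
      (∀ s ∈ Ioo 0 L, normCurv β Γ s =
        Real.cosh (β * s) • w₀ + (Real.sinh (β * s) / β) • v₀) ∧
      ∃ c : ℝ, c = √(1 - ‖w₀‖ ^ 2 + (β ^ 2)⁻¹ * ‖v₀‖ ^ 2) ∧ 0 < c ∧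
        ∀ s ∈ Ioo 0 L,
          (Γ s).lam 0 ^ 2 + (Γ s).lam 1 ^ 2 + (Γ s).lam 2 ^ 2 = c ^ 2 * β ^ 2 ∧
          (β ^ 2)⁻¹ * (Γ s).lam 2 ^ 2 + (Γ s).lam 3 ^ 2 + (Γ s).lam 4 ^ 2 = 1 := by
  obtain ⟨w₀, v₀, h⟩ := exists_cosh_sinh hβ hL (fun s hs => hΓ.hasDerivAt_normCurv hβ hs)
    fun s hs => hΓ.hasDerivAt_deriv_normCurv hβ hσ hs
  have hnhds : Ioo 0 L ∈ 𝓝[>] (0 : ℝ) := Ioo_mem_nhdsGT hL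
  have hquad : ∀ s ∈ Ioo 0 L, (Γ s).lam 0 ^ 2 + (Γ s).lam 1 ^ 2 + (Γ s).lam 2 ^ 2 =
      (1 - ‖w₀‖ ^ 2 + (β ^ 2)⁻¹ * ‖v₀‖ ^ 2) * β ^ 2 := fun s hs => by
    rw [(hΓ.conservation hβ hσ hs).1, (h s hs).1, (h s hs).2]
    have hcs := Real.cosh_sq (β * s)
    simp only [E2.norm_sq, PiLp.add_apply, PiLp.smul_apply, smul_eq_mul]
    field_simp
    -- The quadratic form ‖w'‖² - β²‖w‖² is invariant under the hyperbolic flow, by cosh² - sinh² =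
    -- 1.
    linear_combination (v₀ 0 ^ 2 + v₀ 1 ^ 2 - β ^ 2 * (w₀ 0 ^ 2 + w₀ 1 ^ 2)) * hcs
  have hpos : 0 < 1 - ‖w₀‖ ^ 2 + (β ^ 2)⁻¹ * ‖v₀‖ ^ 2 := by
    -- The quantity is constant, so positivity of λ₃ at any one point suffices.
    have hs : L / 2 ∈ Ioo 0 L := ⟨by linarith, by linarith⟩
    have h2 : 0 < (Γ (L / 2)).lam 2 := by rw [hΓ.lam_two hβ hs]; positivity
    refine pos_of_mul_pos_left ?_ (sq_nonneg β)
    rw [← hquad _ hs]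
    positivity
  refine ⟨w₀, v₀, ?_, ?_, fun s hs => (h s hs).1, _, rfl, Real.sqrt_pos.2 hpos, fun s hs =>
    ⟨by rw [Real.sq_sqrt hpos.le, hquad s hs], (hΓ.conservation hβ hσ hs).2⟩⟩
  · have hc : Continuous fun s => Real.cosh (β * s) • w₀ + (Real.sinh (β * s) / β) • v₀ := by
      fun_prop
    have ht := (hc.tendsto 0).mono_left (nhdsWithin_le_nhds (s := Ioi 0))
    simp only [mul_zero, Real.cosh_zero, Real.sinh_zero, zero_div, one_smul, zero_smul,
      add_zero] at ht
    exact ht.congr' (by filter_upwards [hnhds] with s hs using (h s hs).1.symm)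
  · have hc : Continuous fun s => (β * Real.sinh (β * s)) • w₀ + Real.cosh (β * s) • v₀ := by
      fun_prop
    have ht := (hc.tendsto 0).mono_left (nhdsWithin_le_nhds (s := Ioi 0))
    simp only [mul_zero, Real.cosh_zero, Real.sinh_zero, one_smul, zero_smul, zero_add] at ht
    exact ht.congr' (by filter_upwards [hnhds] with s hs using (h s hs).2.symm)

end IsStationaryZ

/-! ### Existence of horizontal lifts -/

theorem mem_SO3_of_orthonormal {p t : Fin 3 → ℝ} (hp : p 0 ^ 2 + p 1 ^ 2 + p 2 ^ 2 = 1)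
    (ht : t 0 ^ 2 + t 1 ^ 2 + t 2 ^ 2 = 1) (hpt : p 0 * t 0 + p 1 * t 1 + p 2 * t 2 = 0) :
    (!![p 0, t 1 * p 2 - t 2 * p 1, t 0; p 1, t 2 * p 0 - t 0 * p 2, t 1;
      p 2, t 0 * p 1 - t 1 * p 0, t 2] : M3) ∈ Matrix.specialOrthogonalGroup (Fin 3) ℝ := by
  have hq : (t 1 * p 2 - t 2 * p 1) ^ 2 + (t 2 * p 0 - t 0 * p 2) ^ 2 +
      (t 0 * p 1 - t 1 * p 0) ^ 2 = 1 := by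
    linear_combination (p 0 ^ 2 + p 1 ^ 2 + p 2 ^ 2) * ht + hp -
      (p 0 * t 0 + p 1 * t 1 + p 2 * t 2) * hpt
  refine mem_SO3 ?_ ?_
  · ext i j
    fin_cases i <;> fin_cases j <;> simp [Matrix.mul_apply, Fin.sum_univ_three] <;>
      first | ring1 | linear_combination hp | linear_combination ht | linear_combination hpt |
        linear_combination hq
  · simp only [Matrix.det_fin_three, Matrix.of_apply, Matrix.cons_val', Matrix.cons_val_zero,
      Matrix.cons_val_one, Matrix.cons_val]
    linear_combination hq

/-- A smooth curve of directions misses some line through the origin. -/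
theorem exists_forall_ne_smul {T : ℝ → E3} {a b : ℝ} (hT : ContDiffOn ℝ ∞ T (Ioo a b)) :
    ∃ v : E3, ∀ s ∈ Ioo a b, ∀ c : ℝ, c • T s ≠ v := by
  have hf : ContDiffOn ℝ 1 (fun p : ℝ × ℝ => p.1 • T p.2) (univ ×ˢ Ioo a b) :=
    contDiffOn_fst.smul ((hT.of_le (by norm_cast)).comp contDiffOn_snd fun p hp => hp.2)
  have hdim : dimH (univ ×ˢ Ioo a b : Set (ℝ × ℝ)) < Module.finrank ℝ E3 := by
    refine (dimH_mono (subset_univ _)).trans_lt ?_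
    rw [Real.dimH_univ_eq_finrank]
    simp
    norm_num
  -- The cone {c T(s)} is a C¹ image of a subset of the plane, so its complement in ℝ³ is dense.
  obtain ⟨v, hv⟩ := (hf.dense_compl_image_of_dimH_lt_finrank (convex_univ.prod (convex_Ioo a b))
    Subset.rfl hdim).nonempty
  exact ⟨v, fun s hs c h => hv ⟨(c, s), ⟨trivial, hs⟩, h⟩⟩

/-- For a fixed v never parallel to T, the field v × T has no zeros. Normalizing it gives a smooth
unit normal p, and the frame is (p, T × p, T). -/
theorem exists_frame {T : ℝ → E3} {a b : ℝ} (hT : ContDiffOn ℝ ∞ T (Ioo a b))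
    (h1 : ∀ s ∈ Ioo a b, ‖T s‖ = 1) :
    ∃ R : ℝ → Matrix.specialOrthogonalGroup (Fin 3) ℝ,
      (∀ i j, ContDiffOn ℝ ∞ (fun s => (R s : M3) i j) (Ioo a b)) ∧
      ∀ s ∈ Ioo a b, ∀ k, (R s : M3) k 2 = T s k := by
  obtain ⟨v, hv⟩ := exists_forall_ne_smul hT
  have hTk := contDiffOn_euclidean.1 hT
  set c : ℝ → Fin 3 → ℝ := fun s => ![v 1 * T s 2 - v 2 * T s 1, v 2 * T s 0 - v 0 * T s 2,
    v 0 * T s 1 - v 1 * T s 0] with hc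
  have hck : ∀ k, ContDiffOn ℝ ∞ (fun s => c s k) (Ioo a b) := by
    intro k
    fin_cases k
    · exact (contDiffOn_const.mul (hTk 2)).sub (contDiffOn_const.mul (hTk 1))
    · exact (contDiffOn_const.mul (hTk 0)).sub (contDiffOn_const.mul (hTk 2))
    · exact (contDiffOn_const.mul (hTk 1)).sub (contDiffOn_const.mul (hTk 0))
  have hTT : ∀ s ∈ Ioo a b, T s 0 ^ 2 + T s 1 ^ 2 + T s 2 ^ 2 = 1 := fun s hs => by
    rw [← E3.norm_sq, h1 s hs, one_pow]
  have hpos : ∀ s ∈ Ioo a b, 0 < c s 0 ^ 2 + c s 1 ^ 2 + c s 2 ^ 2 := by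
    intro s hs
    set d := v 0 * T s 0 + v 1 * T s 1 + v 2 * T s 2 with hd
    -- |v × T|² is the squared length of the part of v orthogonal to T, nonzero by the choice of v.
    have hne : 0 < ‖v - d • T s‖ ^ 2 :=
      pow_pos (norm_pos_iff.2 (sub_ne_zero.2 (hv s hs d).symm)) 2
    rw [E3.norm_sq] at hne
    simp only [PiLp.sub_apply, PiLp.smul_apply, smul_eq_mul] at hne
    refine hne.trans_eq ?_
    simp only [hc, Matrix.cons_val_zero, Matrix.cons_val_one, Matrix.cons_val]
    rw [hd]
    linear_combination ((v 0 * T s 0 + v 1 * T s 1 + v 2 * T s 2) ^ 2 -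
      (v 0 ^ 2 + v 1 ^ 2 + v 2 ^ 2)) * hTT s hs
  set p : ℝ → Fin 3 → ℝ := fun s k => c s k / √(c s 0 ^ 2 + c s 1 ^ 2 + c s 2 ^ 2) with hp
  have hpk : ∀ k, ContDiffOn ℝ ∞ (fun s => p s k) (Ioo a b) := fun k =>
    (hck k).div (((((hck 0).pow 2).add ((hck 1).pow 2)).add ((hck 2).pow 2)).sqrt
      fun s hs => (hpos s hs).ne') fun s hs => (Real.sqrt_pos.2 (hpos s hs)).ne'
  have key : ∀ s, ∃ R : Matrix.specialOrthogonalGroup (Fin 3) ℝ, s ∈ Ioo a b →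
      (R : M3) = !![p s 0, T s 1 * p s 2 - T s 2 * p s 1, T s 0;
        p s 1, T s 2 * p s 0 - T s 0 * p s 2, T s 1;
        p s 2, T s 0 * p s 1 - T s 1 * p s 0, T s 2] := by
    intro s
    by_cases hs : s ∈ Ioo a b
    · refine ⟨⟨_, mem_SO3_of_orthonormal (p := p s) (t := WithLp.ofLp (T s)) ?_ (hTT s hs) ?_⟩,
        fun _ => rfl⟩
      · simp only [hp, div_pow, Real.sq_sqrt (hpos s hs).le]
        rw [← add_div, ← add_div, div_self (hpos s hs).ne']
      · simp only [hp, div_mul_eq_mul_div]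
        rw [← add_div, ← add_div, div_eq_zero_iff]
        left
        simp only [hc, Matrix.cons_val_zero, Matrix.cons_val_one, Matrix.cons_val]
        ring
    -- Outside the interval the identity is an arbitrary filler.
    · exact ⟨1, fun h => absurd h hs⟩
  choose R hR using key
  refine ⟨R, fun i j => ?_, fun s hs k => ?_⟩
  · refine ContDiffOn.congr (f := fun s => (!![p s 0, T s 1 * p s 2 - T s 2 * p s 1, T s 0;
        p s 1, T s 2 * p s 0 - T s 0 * p s 2, T s 1;
        p s 2, T s 0 * p s 1 - T s 1 * p s 0, T s 2] : M3) i j) ?_ fun s hs => by rw [hR s hs]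
    have hcross : ∀ i j, ContDiffOn ℝ ∞ (fun s => T s i * p s j - T s j * p s i) (Ioo a b) :=
      fun i j => ((hTk i).mul (hpk j)).sub ((hTk j).mul (hpk i))
    fin_cases i <;> fin_cases j
    exacts [hpk 0, hcross 1 2, hTk 0, hpk 1, hcross 2 0, hTk 1, hpk 2, hcross 0 1, hTk 2]
  · rw [hR s hs]
    fin_cases k <;> rfl

theorem exists_antideriv {f : ℝ → ℝ} {a b : ℝ} (hf : ContDiffOn ℝ ∞ f (Ioo a b)) :
    ∃ F : ℝ → ℝ, ContDiffOn ℝ ∞ F (Ioo a b) ∧ ∀ s ∈ Ioo a b, HasDerivAt F (f s) s := by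
  -- An interior base point is used because f need not be integrable up to the ends.
  have hd : ∀ s ∈ Ioo a b, HasDerivAt (fun u => ∫ q in (a + b) / 2..u, f q) (f s) s := by
    intro s hs
    have hmid : (a + b) / 2 ∈ Ioo a b := ⟨by linarith [hs.1, hs.2], by linarith [hs.1, hs.2]⟩
    refine intervalIntegral.integral_hasDerivAt_right ?_ ?_ ?_
    · exact (hf.continuousOn.mono (ordConnected_Ioo.uIcc_subset hmid hs)).intervalIntegrable
    · exact hf.continuousOn.stronglyMeasurableAtFilter isOpen_Ioo s hs
    · exact hf.continuousOn.continuousAt (isOpen_Ioo.mem_nhds hs)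
  refine ⟨_, ?_, hd⟩
  rw [contDiffOn_infty_iff_deriv_of_isOpen isOpen_Ioo]
  exact ⟨fun s hs => (hd s hs).differentiableAt.differentiableWithinAt,
    hf.congr fun s hs => (hd s hs).deriv⟩

theorem contDiffOn_coframeAlong {g : ℝ → SE3} {U : Set ℝ} (hU : IsOpen U)
    (hp : ContDiffOn ℝ ∞ (fun s => (g s).pos) U)
    (hr : ∀ i j, ContDiffOn ℝ ∞ (fun s => (g s).mat i j) U) (i : Fin 6) :
    ContDiffOn ℝ ∞ (fun s => coframeAlong g s i) U :=
  SmoothOn.coframeAlong (Γ := fun s => ⟨g s, 0, ⟨1, one_pos⟩, 0⟩)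
    ⟨hp, hr, contDiffOn_const, contDiffOn_const, fun _ => contDiffOn_const⟩ hU i

/-- Turning a moving frame about its `z`-axis changes `ω⁶` by the angular speed. -/
theorem rotForm_mul_rotZ {g h : ℝ → SE3} {α : ℝ → ℝ} {α' s : ℝ}
    (hg : ∀ i j, DifferentiableAt ℝ (fun q => (g q).mat i j) s) (hα : HasDerivAt α α' s)
    (hh : ∀ q, (h q).mat = (g q).mat * rotZ (α q)) :
    rotForm h s 1 0 = rotForm g s 1 0 + α' := by
  have hZ : ∀ i j, HasDerivAt (fun q => rotZ (α q) i j)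
      ((!![-Real.sin (α s) * α', -(Real.cos (α s) * α'), 0;
        Real.cos (α s) * α', -Real.sin (α s) * α', 0; 0, 0, 0] : M3) i j) s := by
    intro i j
    fin_cases i <;> fin_cases j <;>
      first | exact hasDerivAt_const _ _ | exact hα.cos | exact hα.sin | exact hα.sin.neg
  have hvel : rotVel h s = rotVel g s * rotZ (α s) + (g s).mat *
      !![-Real.sin (α s) * α', -(Real.cos (α s) * α'), 0;
        Real.cos (α s) * α', -Real.sin (α s) * α', 0; 0, 0, 0] := by
    ext i j
    refine Eq.trans ?_ (hasDerivAt_mul_apply (A' := rotVel g s)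
      (fun i j => (hg i j).hasDerivAt) hZ i j).deriv
    simp [rotVel, hh]
  have e : rotForm h s = (rotZ (α s))ᵀ * rotForm g s * rotZ (α s) + (rotZ (α s))ᵀ *
      !![-Real.sin (α s) * α', -(Real.cos (α s) * α'), 0;
        Real.cos (α s) * α', -Real.sin (α s) * α', 0; 0, 0, 0] := by
    rw [rotForm, hvel, hh, Matrix.transpose_mul, Matrix.mul_add, rotVel_eq_mul g]
    simp only [Matrix.mul_assoc]
    rw [← Matrix.mul_assoc (g s).matᵀ, ← Matrix.mul_assoc (g s).matᵀ, SE3.transpose_mul_mat,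
      Matrix.one_mul, Matrix.one_mul]
  -- Conjugation by a z-rotation preserves the (1,0) entry of an antisymmetric matrix, hence only α'
  -- is added.
  have a0 : rotForm g s 0 0 = 0 := by linarith [rotForm_antisymm hg 0 0]
  have a1 : rotForm g s 1 1 = 0 := by linarith [rotForm_antisymm hg 1 1]
  have a2 := rotForm_antisymm hg 0 1
  have hcs := Real.sin_sq_add_cos_sq (α s)
  rw [e, Matrix.add_apply, Matrix.mul_apply, Matrix.mul_apply]
  simp [Matrix.mul_apply, Fin.sum_univ_three, rotZ, a0, a1, a2]
  linear_combination (rotForm g s 1 0 + α') * hcs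

/-- Any frame with third column x' already has ω¹ = ω² = 0. Turning it about its z-axis by an
antiderivative of -ω⁶ keeps that column and removes ω⁶. -/
theorem exists_isHorizontalLift {L : ℝ} {x : ℝ → E3} (hx : ContDiffOn ℝ ∞ x (Ioo 0 L))
    (h1 : ∀ s ∈ Ioo 0 L, ‖deriv x s‖ = 1) : ∃ g, IsHorizontalLift L x g := by
  have hT : ContDiffOn ℝ ∞ (deriv x) (Ioo 0 L) := hx.deriv_of_isOpen isOpen_Ioo le_rfl
  obtain ⟨R, hR, hR2⟩ := exists_frame hT h1
  set g : ℝ → SE3 := fun s => ⟨x s, R s⟩ with hg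
  obtain ⟨α, hα, hα'⟩ := exists_antideriv
    (contDiffOn_coframeAlong (g := g) isOpen_Ioo hx hR 5).neg
  set h : ℝ → SE3 := fun s => ⟨x s, R s * ⟨rotZ (α s), rotZ_mem _⟩⟩ with hh
  have hmat : ∀ s, (h s).mat = (g s).mat * rotZ (α s) := fun s => rfl
  have hdir : ∀ s ∈ Ioo 0 L, (h s).dir = deriv x s := fun s hs => by
    ext k
    rw [SE3.dir_apply, hmat, ← hR2 s hs k]
    simp [Matrix.mul_apply, Fin.sum_univ_three, rotZ, hg, SE3.mat]
  refine ⟨h, fun s _ => rfl, hdir, fun i j => ?_, fun s hs => ?_⟩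
  · have hZ : ∀ i j, ContDiffOn ℝ ∞ (fun q => rotZ (α q) i j) (Ioo 0 L) := by
      intro i j
      fin_cases i <;> fin_cases j <;>
        first | exact contDiffOn_const | exact hα.cos | exact hα.sin | exact hα.sin.neg
    exact ContDiffOn.sum (s := Finset.univ) fun k _ => (hR i k).mul (hZ k j)
  · have hpos : posForm h s = (h s).matᵀ *ᵥ ((h s).mat *ᵥ WithLp.ofLp ez) := by
      rw [posForm, show deriv (fun q => (h q).pos) s = (h s).dir from (hdir s hs).symm]
      rfl
    rw [Matrix.mulVec_mulVec, SE3.transpose_mul_mat, Matrix.one_mulVec] at hpos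
    refine ⟨?_, ?_, ?_⟩
    · exact (congrFun hpos 0).trans (by simp [ez])
    · exact (congrFun hpos 1).trans (by simp [ez])
    · refine (rotForm_mul_rotZ (fun i j => ?_) (hα' s hs) hmat).trans (add_neg_cancel _)
      exact ((hR i j).contDiffAt (isOpen_Ioo.mem_nhds hs)).differentiableAt (by simp)

/-! ### The first variation of the energy -/

section Density

open scoped RealInnerProductSpace

variable {β : ℝ}

/-- The integrand of the energy as a function of the first two derivatives of the curve. -/
def energyDensity (β : ℝ) (p q : E3) : ℝ :=
  √((‖p‖ ^ 2 * ‖q‖ ^ 2 - ⟪p, q⟫ ^ 2) / (‖p‖ ^ 2) ^ 2 + β ^ 2 * ‖p‖ ^ 2)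

theorem energyDensity_arg_pos (hβ : 0 < β) {p : E3} (hp : p ≠ 0) (q : E3) :
    0 < (‖p‖ ^ 2 * ‖q‖ ^ 2 - ⟪p, q⟫ ^ 2) / (‖p‖ ^ 2) ^ 2 + β ^ 2 * ‖p‖ ^ 2 := by
  have h1 : 0 < ‖p‖ := norm_pos_iff.2 hp
  have h2 : ⟪p, q⟫ ^ 2 ≤ ‖p‖ ^ 2 * ‖q‖ ^ 2 := by
    rw [← mul_pow, ← sq_abs ⟪p, q⟫]
    exact pow_le_pow_left₀ (abs_nonneg _) (abs_real_inner_le_norm p q) 2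
  have h3 : 0 ≤ (‖p‖ ^ 2 * ‖q‖ ^ 2 - ⟪p, q⟫ ^ 2) / (‖p‖ ^ 2) ^ 2 :=
    div_nonneg (sub_nonneg.2 h2) (by positivity)
  positivity

/-- The derivative of p/‖p‖ is the part of q orthogonal to p, divided by ‖p‖; its squared norm is a
Gram determinant over ‖p‖⁴. This exhibits the integrand as a smooth function of (p, q) with p ≠ 0.
-/
theorem sqrt_curvature_mul_norm {y : ℝ → E3} {s : ℝ} {q : E3} (hq : HasDerivAt (deriv y) q s)
    (hp : deriv y s ≠ 0) :
    √(curvature y s ^ 2 + β ^ 2) * ‖deriv y s‖ = energyDensity β (deriv y s) q := by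
  set p := deriv y s with hpdef
  have hn : 0 < ‖p‖ := norm_pos_iff.2 hp
  have hnorm : HasDerivAt (fun r => ‖deriv y r‖) (⟪p, q⟫ / ‖p‖) s := by
    have h := (hq.norm_sq).sqrt (pow_pos hn 2).ne'
    simp only [Real.sqrt_sq (norm_nonneg _)] at h
    refine h.congr_deriv ?_
    rw [mul_div_mul_left _ _ two_ne_zero]
  have hU : deriv (unitTangent y) s = ‖p‖⁻¹ • q + (-(⟪p, q⟫ / ‖p‖) / ‖p‖ ^ 2) • p :=
    ((hnorm.fun_inv hn.ne').fun_smul hq).deriv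
  have hU2 : ‖deriv (unitTangent y) s‖ ^ 2 =
      (‖p‖ ^ 2 * ‖q‖ ^ 2 - ⟪p, q⟫ ^ 2) / (‖p‖ ^ 2) ^ 2 := by
    rw [hU, norm_add_sq_real, norm_smul, norm_smul, inner_smul_left, inner_smul_right,
      real_inner_comm p q, mul_pow, mul_pow, Real.norm_eq_abs, Real.norm_eq_abs, sq_abs, sq_abs]
    simp only [conj_trivial]
    field_simp
    ring
  rw [energyDensity, ← hU2, curvature, ← hpdef]
  conv_lhs => rw [← Real.sqrt_sq hn.le]
  rw [← Real.sqrt_mul (by positivity)]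
  congr 1
  rw [Real.sqrt_sq hn.le]
  field_simp

theorem contDiffOn_energyDensity (hβ : 0 < β) {V : Type*} [NormedAddCommGroup V] [NormedSpace ℝ V]
    {W : Set V} {p q : V → E3} (hp : ContDiffOn ℝ ∞ p W) (hq : ContDiffOn ℝ ∞ q W)
    (h0 : ∀ z ∈ W, p z ≠ 0) : ContDiffOn ℝ ∞ (fun z => energyDensity β (p z) (q z)) W := by
  refine ContDiffOn.sqrt ?_ fun z hz => (energyDensity_arg_pos hβ (h0 z hz) _).ne'
  refine ContDiffOn.add (ContDiffOn.div ?_ ((hp.norm_sq ℝ).pow 2) fun z hz => ?_)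
    (contDiffOn_const.mul (hp.norm_sq ℝ))
  · exact ((hp.norm_sq ℝ).mul (hq.norm_sq ℝ)).sub ((hp.inner ℝ hq).pow 2)
  · have := norm_pos_iff.2 (h0 z hz)
    positivity

/-- At unit speed with q ⟂ p, the term ⟪p, q⟫² is of second order and drops out; differentiating the
denominator ‖p‖⁴ is what reverses the sign of ‖q‖². -/
theorem hasDerivAt_energyDensity (hβ : 0 < β) {p q η ζ : E3} (hp : ‖p‖ = 1) (hpq : ⟪p, q⟫ = 0) :
    HasDerivAt (fun t : ℝ => energyDensity β (p + t • η) (q + t • ζ))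
      ((⟪q, ζ⟫ + (β ^ 2 - ‖q‖ ^ 2) * ⟪p, η⟫) / √(‖q‖ ^ 2 + β ^ 2)) 0 := by
  have hlin : ∀ u v : E3, HasDerivAt (fun t : ℝ => u + t • v) v 0 := fun u v => by
    simpa using ((hasDerivAt_id (0 : ℝ)).smul_const v).const_add u
  have hA := (hlin p η).norm_sq
  have hB := (hlin q ζ).norm_sq
  have hC := (hlin p η).inner ℝ (hlin q ζ)
  have h1 := ((hA.mul hB).sub (hC.fun_pow 2)).div (hA.fun_pow 2) (by simp [hp])
  have h2 := (h1.add (hA.const_mul (β ^ 2))).sqrt (by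
    simp [hp, hpq]
    positivity)
  refine h2.congr_deriv ?_
  simp [hp, hpq]
  have hE : √(‖q‖ ^ 2 + β ^ 2) ≠ 0 := (Real.sqrt_pos.2 (by positivity)).ne'
  field_simp
  ring

end Density

section Variation

open scoped RealInnerProductSpace

variable {β L : ℝ} {x₁ n₁ : E3} {x : ℝ → E3}

/-- The integrand of the energy. -/
def energyIntegrand (β : ℝ) (y : ℝ → E3) (s : ℝ) : ℝ := √(curvature y s ^ 2 + β ^ 2) * ‖deriv y s‖

theorem energyIntegrand_congr {y z : ℝ → E3} {s : ℝ} (h : y =ᶠ[𝓝 s] z) :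
    energyIntegrand β y s = energyIntegrand β z s := by
  have h1 : deriv y =ᶠ[𝓝 s] deriv z := h.deriv
  have h2 : unitTangent y =ᶠ[𝓝 s] unitTangent z := by
    filter_upwards [h1] with q hq
    rw [unitTangent, unitTangent, hq]
  rw [energyIntegrand, energyIntegrand, curvature, curvature, h2.deriv_eq, h1.self_of_nhds]

namespace IsStationaryCurve

theorem contDiffOn_deriv (hx : IsStationaryCurve β L x₁ n₁ x) :
    ContDiffOn ℝ ∞ (deriv x) (Ioo 0 L) :=
  hx.smooth.deriv_of_isOpen isOpen_Ioo le_rfl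

theorem contDiffOn_deriv_deriv (hx : IsStationaryCurve β L x₁ n₁ x) :
    ContDiffOn ℝ ∞ (deriv (deriv x)) (Ioo 0 L) :=
  hx.contDiffOn_deriv.deriv_of_isOpen isOpen_Ioo le_rfl

theorem hasDerivAt (hx : IsStationaryCurve β L x₁ n₁ x) {s : ℝ} (hs : s ∈ Ioo 0 L) :
    HasDerivAt x (deriv x s) s :=
  ((hx.smooth.contDiffAt (isOpen_Ioo.mem_nhds hs)).differentiableAt (by simp)).hasDerivAt

theorem hasDerivAt_deriv (hx : IsStationaryCurve β L x₁ n₁ x) {s : ℝ} (hs : s ∈ Ioo 0 L) :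
    HasDerivAt (deriv x) (deriv (deriv x) s) s :=
  ((hx.contDiffOn_deriv.contDiffAt (isOpen_Ioo.mem_nhds hs)).differentiableAt (by simp)).hasDerivAt

theorem inner_deriv_deriv (hx : IsStationaryCurve β L x₁ n₁ x) {s : ℝ} (hs : s ∈ Ioo 0 L) :
    ⟪deriv x s, deriv (deriv x) s⟫ = 0 := by
  have h := (hx.hasDerivAt_deriv hs).norm_sq
  have h' : HasDerivAt (‖deriv x ·‖ ^ 2) 0 s :=
    (hasDerivAt_const s (1 : ℝ)).congr_of_eventuallyEq <| by
      filter_upwards [isOpen_Ioo.mem_nhds hs] with q hq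
      simp [hx.unit_speed q hq]
  linarith [h.unique h']

theorem integrableOn_energyIntegrand (hx : IsStationaryCurve β L x₁ n₁ x) (hβ : 0 < β)
    (hL : 0 < L) : IntegrableOn (energyIntegrand β x) (Ioo 0 L) := by
  have h1 : IntegrableOn (curvature x) (Ioo 0 L) :=
    ((intervalIntegrable_iff_integrableOn_Ioo_of_le hL.le).1 hx.integrable)
  have h2 : IntegrableOn (fun s => √(curvature x s ^ 2 + β ^ 2)) (Ioo 0 L) := by
    refine Integrable.mono' (g := fun s => |curvature x s| + β)
      (h1.abs.add (integrableOn_const (by simp))) ?_ (ae_of_all _ fun s => ?_)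
    · have hc : Continuous fun k : ℝ => √(k ^ 2 + β ^ 2) := by fun_prop
      exact hc.comp_aestronglyMeasurable h1.aestronglyMeasurable
    · rw [Real.norm_of_nonneg (Real.sqrt_nonneg _), Real.sqrt_le_left (by positivity)]
      nlinarith [abs_nonneg (curvature x s), sq_abs (curvature x s)]
  exact h2.congr_fun (fun s hs => by simp [energyIntegrand, hx.unit_speed s hs]) measurableSet_Ioo

/-- The first variation of the energy along `φ v`. -/
theorem integral_eq_zero (hx : IsStationaryCurve β L x₁ n₁ x) (hβ : 0 < β) {a b : ℝ} (ha : 0 < a)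
    (hab : a < b) (hb : b < L) {φ : ℝ → ℝ} (hφ : ContDiff ℝ ∞ φ) (hs : tsupport φ ⊆ Ioo a b)
    (v : E3) :
    ∫ s in a..b, (⟪deriv (deriv x) s, deriv (deriv φ) s • v⟫ +
      (β ^ 2 - ‖deriv (deriv x) s‖ ^ 2) * ⟪deriv x s, deriv φ s • v⟫) /
        √(‖deriv (deriv x) s‖ ^ 2 + β ^ 2) = 0 := by
  have hL : 0 < L := ha.trans (hab.trans hb)
  have hsub : Icc a b ⊆ Ioo 0 L := fun r hr => ⟨ha.trans_le hr.1, hr.2.trans_lt hb⟩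
  have hφ1 : ContDiff ℝ ∞ (deriv φ) := (contDiff_infty_iff_deriv.1 hφ).2
  have hφ2 : ContDiff ℝ ∞ (deriv (deriv φ)) := (contDiff_infty_iff_deriv.1 hφ1).2
  have hd0 : ∀ s, HasDerivAt φ (deriv φ s) s := fun s =>
    (hφ.differentiable (by simp) s).hasDerivAt
  have hd1 : ∀ s, HasDerivAt (deriv φ) (deriv (deriv φ) s) s := fun s =>
    (hφ1.differentiable (by simp) s).hasDerivAt
  set F : ℝ → ℝ → E3 := fun t s => x s + (t * φ s) • v with hF
  set p : ℝ × ℝ → E3 := fun z => deriv x z.2 + (z.1 * deriv φ z.2) • v with hp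
  set q : ℝ × ℝ → E3 := fun z => deriv (deriv x) z.2 + (z.1 * deriv (deriv φ) z.2) • v with hq
  have hopen : IsOpen (univ ×ˢ Ioo 0 L : Set (ℝ × ℝ)) := isOpen_univ.prod isOpen_Ioo
  have hsnd : MapsTo (Prod.snd : ℝ × ℝ → ℝ) (univ ×ˢ Ioo 0 L) (Ioo 0 L) := fun z hz => hz.2
  have hpc : ContDiffOn ℝ ∞ p (univ ×ˢ Ioo 0 L) :=
    (hx.contDiffOn_deriv.comp contDiffOn_snd hsnd).add
      ((contDiffOn_fst.mul (hφ1.comp contDiff_snd).contDiffOn).smul contDiffOn_const)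
  have hqc : ContDiffOn ℝ ∞ q (univ ×ˢ Ioo 0 L) :=
    (hx.contDiffOn_deriv_deriv.comp contDiffOn_snd hsnd).add
      ((contDiffOn_fst.mul (hφ2.comp contDiff_snd).contDiffOn).smul contDiffOn_const)
  have hF1 : ∀ t, ∀ s ∈ Ioo 0 L, deriv (F t) s = p (t, s) := fun t s hs =>
    ((hx.hasDerivAt hs).fun_add (((hd0 s).const_mul t).smul_const v)).deriv
  have hF2 : ∀ t, ∀ s ∈ Ioo 0 L, HasDerivAt (deriv (F t)) (q (t, s)) s := fun t s hs =>
    ((hx.hasDerivAt_deriv hs).fun_add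
      (((hd1 s).const_mul t).smul_const v)).congr_of_eventuallyEq <| by
      filter_upwards [isOpen_Ioo.mem_nhds hs] with r hr using hF1 t r hr
  -- The varied curves are regular only for small t; `W` is the open set of regular points and
  -- contains the slice t = 0.
  set W : Set (ℝ × ℝ) := (univ ×ˢ Ioo 0 L) ∩ p ⁻¹' {0}ᶜ with hW
  have hWo : IsOpen W := hpc.continuousOn.isOpen_inter_preimage hopen isOpen_compl_singleton
  have hW0 : ∀ s ∈ Icc a b, ((0 : ℝ), s) ∈ W := fun s hs => by
    refine ⟨⟨trivial, hsub hs⟩, fun h => ?_⟩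
    have h1 := hx.unit_speed s (hsub hs)
    rw [show deriv x s = 0 by simpa [hp] using h, norm_zero] at h1
    exact zero_ne_one h1
  have hdens : ContDiffOn ℝ ∞ (Function.uncurry fun t s => energyDensity β (p (t, s)) (q (t, s))) W :=
    contDiffOn_energyDensity hβ (hpc.mono inter_subset_left) (hqc.mono inter_subset_left)
      fun z hz => hz.2
  have heq : ∀ t s, (t, s) ∈ W →
      energyIntegrand β (F t) s = energyDensity β (p (t, s)) (q (t, s)) := fun t s h => by
    have h1 := hF1 t s h.1.2
    rw [energyIntegrand, sqrt_curvature_mul_norm (hF2 t s h.1.2) (by rw [h1]; exact h.2), h1]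
  have hout : ∀ t, ∀ s ∉ Icc a b, F t =ᶠ[𝓝 s] x := fun t s h => by
    filter_upwards [isClosed_Icc.isOpen_compl.mem_nhds h] with r hr
    have : φ r = 0 := image_eq_zero_of_notMem_tsupport fun h' => hr (Ioo_subset_Icc_self (hs h'))
    simp [hF, this]
  have hvar : IsVariation L x F := by
    refine ⟨?_, fun s _ => by simp [hF], a, b, ha, hb, fun t s _ h => (hout t s h).self_of_nhds⟩
    exact (hx.smooth.comp contDiffOn_snd hsnd).add
      ((contDiffOn_fst.mul (hφ.comp contDiff_snd).contDiffOn).smul contDiffOn_const)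
  have htube : ∀ᶠ t in 𝓝 (0 : ℝ), ∀ s ∈ Icc a b, (t, s) ∈ W :=
    isCompact_Icc.eventually_forall_of_forall_eventually fun s hs => hWo.mem_nhds (hW0 s hs)
  -- The energy splits into a part over [a, b], differentiable under the integral, and a part near
  -- the ends that is independent of t. The latter is finite because the curvature is integrable.
  have henergy : ∀ᶠ t in 𝓝 (0 : ℝ), energy β L (F t) =
      (∫ s in a..b, energyDensity β (p (t, s)) (q (t, s))) +
        ∫ s in Ioo 0 L \ Icc a b, energyIntegrand β x s := by
    filter_upwards [htube] with t ht
    have hin : EqOn (energyIntegrand β (F t)) (fun s => energyDensity β (p (t, s)) (q (t, s)))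
        (Icc a b) := fun s hs => heq t s (ht s hs)
    have hdiff : EqOn (energyIntegrand β (F t)) (energyIntegrand β x) (Ioo 0 L \ Icc a b) :=
      fun s hs => energyIntegrand_congr (hout t s hs.2)
    have hmeas : MeasurableSet (Ioo 0 L \ Icc a b) := measurableSet_Ioo.diff measurableSet_Icc
    have hint : IntegrableOn (energyIntegrand β (F t)) (Ioo 0 L) := by
      rw [← sdiff_union_of_subset hsub]
      refine IntegrableOn.union ?_ ?_
      · exact ((hx.integrableOn_energyIntegrand hβ hL).mono_set sdiff_subset).congr_fun
          hdiff.symm hmeas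
      · exact ((contDiffOn_slice_snd hdens fun s hs => ht s hs).continuousOn.integrableOn_Icc).congr_fun
          hin.symm measurableSet_Icc
    have h1 : energy β L (F t) = ∫ s in Ioo 0 L, energyIntegrand β (F t) s := by
      rw [← integral_Ioc_eq_integral_Ioo, ← intervalIntegral.integral_of_le hL.le]
      rfl
    rw [h1, ← integral_inter_add_sdiff measurableSet_Icc hint, inter_eq_right.2 hsub,
      setIntegral_congr_fun measurableSet_Icc hin, setIntegral_congr_fun hmeas hdiff,
      intervalIntegral.integral_of_le hab.le, integral_Icc_eq_integral_Ioc]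
  have hD := ((hasDerivAt_intervalIntegral hab.le hWo hdens hW0).add_const
    (∫ s in Ioo 0 L \ Icc a b, energyIntegrand β x s)).congr_of_eventuallyEq henergy
  refine Eq.trans ?_ (hD.unique (hx.stationary F hvar))
  refine intervalIntegral.integral_congr fun s hs => ?_
  rw [uIcc_of_le hab.le] at hs
  have h := hasDerivAt_energyDensity (η := deriv φ s • v) (ζ := deriv (deriv φ) s • v) hβ
    (hx.unit_speed s (hsub hs)) (hx.inner_deriv_deriv (hsub hs))
  simp only [smul_smul] at h
  exact h.deriv.symm

end IsStationaryCurve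

end Variation

/-! ### Conservation of linear momentum for stationary spatial curves. -/

section Momentum

open scoped RealInnerProductSpace

variable {β L : ℝ} {x₁ n₁ : E3} {x : ℝ → E3}

/-- The curvature vector of a unit speed curve, divided by `√(κ² + β²)`. -/
def bend (β : ℝ) (x : ℝ → E3) (s : ℝ) : E3 :=
  (√(‖deriv (deriv x) s‖ ^ 2 + β ^ 2))⁻¹ • deriv (deriv x) s

/-- The linear momentum of a unit speed curve, conjugate to translations. -/
def curveMomentum (β : ℝ) (x : ℝ → E3) (s : ℝ) : E3 :=
  ((β ^ 2 - ‖deriv (deriv x) s‖ ^ 2) / √(‖deriv (deriv x) s‖ ^ 2 + β ^ 2)) • deriv x s -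
    deriv (bend β x) s

namespace IsStationaryCurve

theorem contDiffOn_sqrt (hx : IsStationaryCurve β L x₁ n₁ x) (hβ : 0 < β) :
    ContDiffOn ℝ ∞ (fun s => √(‖deriv (deriv x) s‖ ^ 2 + β ^ 2)) (Ioo 0 L) :=
  ((hx.contDiffOn_deriv_deriv.norm_sq ℝ).add contDiffOn_const).sqrt fun s _ => by positivity

theorem contDiffOn_bend (hx : IsStationaryCurve β L x₁ n₁ x) (hβ : 0 < β) :
    ContDiffOn ℝ ∞ (bend β x) (Ioo 0 L) :=
  ((hx.contDiffOn_sqrt hβ).inv fun s _ => (Real.sqrt_pos.2 (by positivity)).ne').smul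
    hx.contDiffOn_deriv_deriv

theorem contDiffOn_curveMomentum (hx : IsStationaryCurve β L x₁ n₁ x) (hβ : 0 < β) :
    ContDiffOn ℝ ∞ (curveMomentum β x) (Ioo 0 L) :=
  (((contDiffOn_const.sub (hx.contDiffOn_deriv_deriv.norm_sq ℝ)).div (hx.contDiffOn_sqrt hβ)
    fun s _ => (Real.sqrt_pos.2 (by positivity)).ne').smul hx.contDiffOn_deriv).sub
    ((hx.contDiffOn_bend hβ).deriv_of_isOpen isOpen_Ioo le_rfl)

theorem hasDerivAt_bend (hx : IsStationaryCurve β L x₁ n₁ x) (hβ : 0 < β) {s : ℝ}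
    (hs : s ∈ Ioo 0 L) : HasDerivAt (bend β x) (deriv (bend β x) s) s :=
  (((hx.contDiffOn_bend hβ).contDiffAt (isOpen_Ioo.mem_nhds hs)).differentiableAt
    (by simp)).hasDerivAt

/-- The linear momentum of a stationary curve is constant. -/
theorem hasDerivAt_curveMomentum (hx : IsStationaryCurve β L x₁ n₁ x) (hβ : 0 < β) {s : ℝ}
    (hs : s ∈ Ioo 0 L) : HasDerivAt (curveMomentum β x) 0 s := by
  have hP := hx.contDiffOn_curveMomentum hβ
  have hP' : ContinuousOn (deriv (curveMomentum β x)) (Ioo 0 L) :=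
    hP.continuousOn_deriv_of_isOpen isOpen_Ioo (by simp)
  have hPd : ∀ r ∈ Ioo 0 L,
      HasDerivAt (curveMomentum β x) (deriv (curveMomentum β x) r) r := fun r hr =>
    ((hP.contDiffAt (isOpen_Ioo.mem_nhds hr)).differentiableAt (by simp)).hasDerivAt
  refine (hPd s hs).congr_deriv ?_
  -- The test direction is the derivative at s itself, so the fundamental lemma for ⟪P', v⟫ yields
  -- ‖P'(s)‖² = 0.
  set v := deriv (curveMomentum β x) s with hv
  rw [← inner_self_eq_zero (𝕜 := ℝ)]
  obtain ⟨a, ha, has⟩ := exists_between hs.1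
  obtain ⟨b, hsb, hb⟩ := exists_between hs.2
  have hab : a < b := has.trans hsb
  have hsub : Icc a b ⊆ Ioo 0 L := fun r hr => ⟨ha.trans_le hr.1, hr.2.trans_lt hb⟩
  refine eqOn_zero_of_integral_smul_eq_zero (a := a) (b := b)
    (f := fun r => ⟪deriv (curveMomentum β x) r, v⟫)
    ((hP'.inner continuousOn_const).mono (Ioo_subset_Icc_self.trans hsub))
    (fun φ hφ _ hsupp => ?_) s ⟨has, hsb⟩
  have hφ1 : ContDiff ℝ ∞ (deriv φ) := (contDiff_infty_iff_deriv.1 hφ).2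
  have hd0 : ∀ r, HasDerivAt φ (deriv φ r) r := fun r => (hφ.differentiable (by simp) r).hasDerivAt
  have hd1 : ∀ r, HasDerivAt (deriv φ) (deriv (deriv φ) r) r := fun r =>
    (hφ1.differentiable (by simp) r).hasDerivAt
  have hzero : ∀ r, r ∉ Ioo a b → φ r = 0 ∧ deriv φ r = 0 := fun r hr =>
    ⟨image_eq_zero_of_notMem_tsupport fun h => hr (hsupp h), by
      by_contra h
      exact hr (hsupp (support_deriv_subset h))⟩
  set I : ℝ → ℝ := fun r => (⟪deriv (deriv x) r, deriv (deriv φ) r • v⟫ +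
      (β ^ 2 - ‖deriv (deriv x) r‖ ^ 2) * ⟪deriv x r, deriv φ r • v⟫) /
        √(‖deriv (deriv x) r‖ ^ 2 + β ^ 2) with hI
  -- Two integrations by parts at once: the ⟪(x''/E)', v⟫ φ' terms cancel, leaving the
  -- first-variation integrand plus φ ⟪P', v⟫. The primitive vanishes at a and b with φ and φ'.
  have hG : ∀ r ∈ Ioo 0 L, HasDerivAt
      (fun r => ⟪bend β x r, v⟫ * deriv φ r + ⟪curveMomentum β x r, v⟫ * φ r)
      (I r + φ r • ⟪deriv (curveMomentum β x) r, v⟫) r := fun r hr => by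
    have h1 := ((hx.hasDerivAt_bend hβ hr).inner ℝ (hasDerivAt_const r v)).fun_mul (hd1 r)
    have h2 := ((hPd r hr).inner ℝ (hasDerivAt_const r v)).fun_mul (hd0 r)
    refine (h1.fun_add h2).congr_deriv ?_
    have e : ⟪curveMomentum β x r, v⟫ = (β ^ 2 - ‖deriv (deriv x) r‖ ^ 2) /
        √(‖deriv (deriv x) r‖ ^ 2 + β ^ 2) * ⟪deriv x r, v⟫ - ⟪deriv (bend β x) r, v⟫ := by
      rw [curveMomentum, inner_sub_left, real_inner_smul_left]
    have e' : ⟪bend β x r, v⟫ = (√(‖deriv (deriv x) r‖ ^ 2 + β ^ 2))⁻¹ * ⟪deriv (deriv x) r, v⟫ := by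
      rw [bend, real_inner_smul_left]
    rw [e, e']
    simp only [hI, real_inner_smul_right, inner_zero_right, smul_eq_mul]
    ring
  have hIc : ContinuousOn I (Icc a b) := by
    have hE := (hx.contDiffOn_sqrt hβ).continuousOn
    have hX := hx.contDiffOn_deriv_deriv.continuousOn
    have hT := hx.contDiffOn_deriv.continuousOn
    refine ContinuousOn.mono (ContinuousOn.div (ContinuousOn.add ?_ ?_) hE
      fun r _ => (Real.sqrt_pos.2 (by positivity)).ne') hsub
    · exact hX.inner (((hφ1.continuous_deriv (by simp)).smul continuous_const).continuousOn)
    · exact (continuousOn_const.sub (hX.norm.pow 2)).mul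
        (hT.inner ((hφ1.continuous.smul continuous_const).continuousOn))
  have hJc : ContinuousOn (fun r => φ r • ⟪deriv (curveMomentum β x) r, v⟫) (Icc a b) :=
    hφ.continuous.continuousOn.smul ((hP'.mono hsub).inner continuousOn_const)
  have hFTC := intervalIntegral.integral_eq_sub_of_hasDerivAt (a := a) (b := b)
    (fun r hr => hG r (hsub (uIcc_of_le hab.le ▸ hr)))
    ((hIc.add hJc).intervalIntegrable_of_Icc hab.le)
  rw [intervalIntegral.integral_add (hIc.intervalIntegrable_of_Icc hab.le)
    (hJc.intervalIntegrable_of_Icc hab.le),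
    hx.integral_eq_zero hβ ha hab hb hφ hsupp v, zero_add] at hFTC
  rw [hFTC, (hzero a (by simp)).1, (hzero a (by simp)).2, (hzero b (by simp)).1,
    (hzero b (by simp)).2]
  simp

end IsStationaryCurve

end Momentum

/-! ### Lifts of stationary curves -/

/-- The lift to `Z` of a stationary curve, for a given horizontal lift `g` to `SE(3)`. -/
def liftZ (β : ℝ) (x : ℝ → E3) (g : ℝ → SE3) (s : ℝ) : Z :=
  let κ : E2 := !₂[coframeAlong g s 4, -coframeAlong g s 3]
  { g := g s
    κ := κ
    σ := ⟨1, one_pos⟩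
    lam := ![∑ k, (g s).mat k 0 * curveMomentum β x s k, ∑ k, (g s).mat k 1 * curveMomentum β x s k,
      ∑ k, (g s).mat k 2 * curveMomentum β x s k,
      -(κ 1 / √(‖κ‖ ^ 2 + β ^ 2)), κ 0 / √(‖κ‖ ^ 2 + β ^ 2), 0] }

section Lift

variable {β L : ℝ} {x₁ n₁ : E3} {x : ℝ → E3} {g : ℝ → SE3} {s : ℝ}

theorem sum_rotVel_mul (g : ℝ → SE3) (s : ℝ) (v : Fin 3 → ℝ) (a : Fin 3) :
    ∑ k, rotVel g s k a * v k = ∑ c, rotForm g s c a * ∑ k, (g s).mat k c * v k := by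
  simp only [rotVel_apply, Finset.sum_mul, Finset.mul_sum]
  rw [Finset.sum_comm]
  exact Finset.sum_congr rfl fun c _ => Finset.sum_congr rfl fun k _ => by ring

/-- The derivative of Rᵀv is a frame-rotation term plus Rᵀv'. It is applied to the constant momentum
and to `bend`. -/
theorem hasDerivAt_sum_mat_mul {v : ℝ → E3} {v' : E3}
    (hg : ∀ i j, DifferentiableAt ℝ (fun q => (g q).mat i j) s) (hv : HasDerivAt v v' s)
    (a : Fin 3) :
    HasDerivAt (fun q => ∑ k, (g q).mat k a * v q k)
      (∑ c, rotForm g s c a * ∑ k, (g s).mat k c * v s k + ∑ k, (g s).mat k a * v' k) s := by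
  rw [← sum_rotVel_mul g s (fun k => v s k), ← Finset.sum_add_distrib]
  exact HasDerivAt.fun_sum fun k _ => (hg k a).hasDerivAt.fun_mul (hasDerivAt_apply hv k)

namespace IsHorizontalLift

theorem differentiableAt (hg : IsHorizontalLift L x g) (hs : s ∈ Ioo 0 L) (i j : Fin 3) :
    DifferentiableAt ℝ (fun q => (g q).mat i j) s :=
  ((hg.smooth i j).contDiffAt (isOpen_Ioo.mem_nhds hs)).differentiableAt (by simp)

theorem deriv_deriv_apply (hg : IsHorizontalLift L x g) (hs : s ∈ Ioo 0 L) (k : Fin 3) :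
    deriv (deriv x) s k =
      (g s).mat k 0 * coframeAlong g s 4 - (g s).mat k 1 * coframeAlong g s 3 := by
  have h : deriv x =ᶠ[𝓝 s] fun q => (g q).dir := by
    filter_upwards [isOpen_Ioo.mem_nhds hs] with q hq using (hg.dir_eq q hq).symm
  rw [h.deriv_eq, (hasDerivAt_dir (hg.differentiableAt hs)).deriv,
    ← rotVel_apply_two (hg.differentiableAt hs)]

theorem norm_sq_deriv_deriv (hg : IsHorizontalLift L x g) (hs : s ∈ Ioo 0 L) :
    ‖deriv (deriv x) s‖ ^ 2 = ‖(!₂[coframeAlong g s 4, -coframeAlong g s 3] : E2)‖ ^ 2 := by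
  have h : deriv x =ᶠ[𝓝 s] fun q => (g q).dir := by
    filter_upwards [isOpen_Ioo.mem_nhds hs] with q hq using (hg.dir_eq q hq).symm
  rw [h.deriv_eq, (hasDerivAt_dir (hg.differentiableAt hs)).deriv,
    norm_sq_dir_deriv (hg.differentiableAt hs), E2.norm_sq]
  simp

/-- Since x'' = κ₁ R e_x + κ₂ R e_y, the body coordinates of x''/E are (w₁, w₂, 0). -/
theorem sum_mat_mul_bend (hg : IsHorizontalLift L x g) (hs : s ∈ Ioo 0 L) :
    ∑ k, (g s).mat k 0 * bend β x s k = normCurv β (liftZ β x g) s 0 ∧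
    ∑ k, (g s).mat k 1 * bend β x s k = normCurv β (liftZ β x g) s 1 ∧
    ∑ k, (g s).mat k 2 * bend β x s k = 0 := by
  have h := fun a b => (g s).sum_mat_mul_mat a b
  have h00 := h 0 0
  have h10 := h 1 0
  have h20 := h 2 0
  have h01 := h 0 1
  have h11 := h 1 1
  have h21 := h 2 1
  simp only [Fin.sum_univ_three, reduceIte, Fin.reduceEq] at h00 h10 h20 h01 h11 h21
  have hb : ∀ k, bend β x s k = (√(‖(liftZ β x g s).κ‖ ^ 2 + β ^ 2))⁻¹ *
      ((g s).mat k 0 * coframeAlong g s 4 - (g s).mat k 1 * coframeAlong g s 3) := fun k => by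
    rw [bend, hg.norm_sq_deriv_deriv hs, PiLp.smul_apply, hg.deriv_deriv_apply hs]
    rfl
  have k0 : (liftZ β x g s).κ 0 = coframeAlong g s 4 := rfl
  have k1 : (liftZ β x g s).κ 1 = -coframeAlong g s 3 := rfl
  simp only [hb, normCurv_apply, k0, k1, Fin.sum_univ_three]
  generalize √(‖(liftZ β x g s).κ‖ ^ 2 + β ^ 2) = E
  refine ⟨?_, ?_, ?_⟩
  · linear_combination E⁻¹ * coframeAlong g s 4 * h00 - E⁻¹ * coframeAlong g s 3 * h01
  · linear_combination E⁻¹ * coframeAlong g s 4 * h10 - E⁻¹ * coframeAlong g s 3 * h11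
  · linear_combination E⁻¹ * coframeAlong g s 4 * h20 - E⁻¹ * coframeAlong g s 3 * h21

theorem theta_liftZ (hg : IsHorizontalLift L x g) (hs : s ∈ Ioo 0 L) (i : Fin 6) :
    theta (liftZ β x g) s i = 0 := by
  obtain ⟨h0, h1, h5⟩ := hg.horizontal s hs
  have hp : (fun q => (g q).pos) =ᶠ[𝓝 s] x := by
    filter_upwards [isOpen_Ioo.mem_nhds hs] with q hq using hg.pos_eq q hq
  have h2 : coframeAlong g s 2 = 1 := by
    have e : posForm g s = (g s).matᵀ *ᵥ ((g s).mat *ᵥ WithLp.ofLp ez) := by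
      rw [posForm, hp.deriv_eq, ← hg.dir_eq s hs]
      rfl
    rw [Matrix.mulVec_mulVec, SE3.transpose_mul_mat, Matrix.one_mulVec] at e
    exact (congrFun e 2).trans (by simp [ez])
  fin_cases i
  · exact (theta_zero ..).trans h0
  · exact (theta_one ..).trans h1
  · exact (theta_two ..).trans (sub_eq_zero.2 h2)
  · refine (theta_three ..).trans ?_
    change coframeAlong g s 3 + -coframeAlong g s 3 * 1 = 0
    ring
  · refine (theta_four ..).trans ?_
    change coframeAlong g s 4 - coframeAlong g s 4 * 1 = 0
    ring
  · exact (theta_five ..).trans h5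

theorem smoothOn_liftZ (hg : IsHorizontalLift L x g) (hx : IsStationaryCurve β L x₁ n₁ x)
    (hβ : 0 < β) : SmoothOn (liftZ β x g) (Ioo 0 L) := by
  have hpos : ContDiffOn ℝ ∞ (fun s => (g s).pos) (Ioo 0 L) := hx.smooth.congr hg.pos_eq
  have hc := contDiffOn_coframeAlong isOpen_Ioo hpos hg.smooth
  have hκ : ContDiffOn ℝ ∞ (fun s => (liftZ β x g s).κ) (Ioo 0 L) := by
    refine contDiffOn_euclidean.2 fun i => ?_
    fin_cases i
    exacts [hc 4, (hc 3).neg]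
  -- The normalized curvature depends on κ alone, so zero multipliers stand in for those whose
  -- smoothness is being proved.
  have hw := contDiffOn_euclidean.1 <| SmoothOn.normCurv (U := Ioo 0 L)
    (Γ := fun s => ⟨g s, (liftZ β x g s).κ, ⟨1, one_pos⟩, 0⟩)
    ⟨hpos, hg.smooth, hκ, contDiffOn_const, fun _ => contDiffOn_const⟩ hβ
  have hP := contDiffOn_euclidean.1 (hx.contDiffOn_curveMomentum hβ)
  have hl : ∀ a, ContDiffOn ℝ ∞ (fun s => ∑ k, (g s).mat k a * curveMomentum β x s k) (Ioo 0 L) :=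
    fun a => ContDiffOn.sum fun k _ => (hg.smooth k a).mul (hP k)
  refine ⟨hpos, hg.smooth, hκ, contDiffOn_const, fun i => ?_⟩
  fin_cases i
  · exact hl 0
  · exact hl 1
  · exact hl 2
  · exact (hw 1).neg.congr fun s _ => congrArg Neg.neg (normCurv_apply β (liftZ β x g) s 1).symm
  · exact (hw 0).congr fun s _ => (normCurv_apply β (liftZ β x g) s 0).symm
  · exact contDiffOn_const

theorem isStationaryZ_liftZ (hg : IsHorizontalLift L x g) (hx : IsStationaryCurve β L x₁ n₁ x)
    (hβ : 0 < β) : IsStationaryZ β L (liftZ β x g) := by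
  refine isStationaryZ_of_eulerLagrange hβ (hg.smoothOn_liftZ hx hβ) (fun s hs => ?_) fun s _ => rfl
  have hθ := hg.theta_liftZ (β := β) hs
  obtain ⟨h0, h1, h5⟩ := hg.horizontal s hs
  have h2 : coframeAlong g s 2 = 1 := sub_eq_zero.1 ((theta_two ..).symm.trans (hθ 2))
  have hl3 : ∀ q, (liftZ β x g q).lam 3 = -normCurv β (liftZ β x g) q 1 := fun q =>
    congrArg Neg.neg (normCurv_apply β (liftZ β x g) q 1).symm
  have hl4 : ∀ q, (liftZ β x g q).lam 4 = normCurv β (liftZ β x g) q 0 := fun q =>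
    (normCurv_apply β (liftZ β x g) q 0).symm
  have hd := hg.differentiableAt hs
  have r00 : rotForm g s 0 0 = 0 := by linarith [rotForm_antisymm hd 0 0]
  have r11 : rotForm g s 1 1 = 0 := by linarith [rotForm_antisymm hd 1 1]
  have r22 : rotForm g s 2 2 = 0 := by linarith [rotForm_antisymm hd 2 2]
  have r10 : rotForm g s 1 0 = coframeAlong g s 5 := rfl
  have r21 : rotForm g s 2 1 = coframeAlong g s 3 := rfl
  have r02 : rotForm g s 0 2 = coframeAlong g s 4 := rfl
  have r01 : rotForm g s 0 1 = -coframeAlong g s 5 := rotForm_antisymm hd 0 1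
  have r12 : rotForm g s 1 2 = -coframeAlong g s 3 := rotForm_antisymm hd 1 2
  have r20 : rotForm g s 2 0 = -coframeAlong g s 4 := rotForm_antisymm hd 2 0
  obtain ⟨b0, b1, b2⟩ := hg.sum_mat_mul_bend (β := β) hs
  have hb := hasDerivAt_sum_mat_mul hd (hx.hasDerivAt_bend hβ hs)
  have hev : ∀ᶠ q in 𝓝 s, q ∈ Ioo 0 L := isOpen_Ioo.mem_nhds hs
  have w0 := (hb 0).congr_of_eventuallyEq (f₁ := fun q => normCurv β (liftZ β x g) q 0)
    (hev.mono fun q hq => (hg.sum_mat_mul_bend hq).1.symm)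
  have w1 := (hb 1).congr_of_eventuallyEq (f₁ := fun q => normCurv β (liftZ β x g) q 1)
    (hev.mono fun q hq => (hg.sum_mat_mul_bend hq).2.1.symm)
  have w2 := ((hb 2).congr_of_eventuallyEq (f₁ := fun _ => (0 : ℝ))
    (hev.mono fun q hq => (hg.sum_mat_mul_bend hq).2.2.symm)).unique (hasDerivAt_const s 0)
  have hP := hasDerivAt_sum_mat_mul hd (hx.hasDerivAt_curveMomentum hβ hs)
  simp only [Fin.sum_univ_three (fun c => rotForm g s c _ * _), b0, b1, b2, r00, r11, r22, r10, r21,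
    r02, r01, r12, r20, h5] at w0 w1 w2 hP
  have hlam : ∀ a, ∑ k, (g s).mat k a * curveMomentum β x s k =
      (β ^ 2 - ‖(liftZ β x g s).κ‖ ^ 2) / √(‖(liftZ β x g s).κ‖ ^ 2 + β ^ 2) *
        (if a = 2 then 1 else 0) - ∑ k, (g s).mat k a * deriv (bend β x) s k := fun a => by
    rw [← (g s).sum_mat_mul_mat a 2, Finset.mul_sum, ← Finset.sum_sub_distrib]
    refine Finset.sum_congr rfl fun k _ => ?_
    rw [curveMomentum, hg.norm_sq_deriv_deriv hs, PiLp.sub_apply, PiLp.smul_apply,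
      ← hg.dir_eq s hs, SE3.dir_apply, smul_eq_mul, mul_sub]
    refine congrArg (· - _) ?_
    rw [mul_left_comm]
    rfl
  have l0 : (liftZ β x g s).lam 0 = ∑ k, (g s).mat k 0 * curveMomentum β x s k := rfl
  have l1 : (liftZ β x g s).lam 1 = ∑ k, (g s).mat k 1 * curveMomentum β x s k := rfl
  have l2 : (liftZ β x g s).lam 2 = ∑ k, (g s).mat k 2 * curveMomentum β x s k := rfl
  have l5 : (liftZ β x g s).lam 5 = 0 := rfl
  have k0 : (liftZ β x g s).κ 0 = coframeAlong g s 4 := rfl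
  have k1 : (liftZ β x g s).κ 1 = -coframeAlong g s 3 := rfl
  have hpos : 0 < ‖(liftZ β x g s).κ‖ ^ 2 + β ^ 2 := by positivity
  have hE := (Real.sqrt_pos.2 hpos).ne'
  have hsq := Real.sq_sqrt hpos.le
  refine eulerLagrange_eq_zero_iff.2 ⟨⟨(hl4 s).symm, by rw [hl3, neg_neg]⟩, ?_, hθ, fun i => ?_⟩
  -- Differentiating the vanishing third body coordinate of `bend` gives ⟪(x''/E)', x'⟫ = -(κ₁w₁ +
  -- κ₂w₂) = -κ²/E. Hence the third component of RᵀP is (β² - κ²)/E + κ²/E = β²/E.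
  · have e : ∑ k, (g s).mat k 2 * deriv (bend β x) s k =
        -((liftZ β x g s).κ 0 * normCurv β (liftZ β x g) s 0 +
          (liftZ β x g s).κ 1 * normCurv β (liftZ β x g) s 1) := by
      rw [k0, k1]
      linarith
    rw [l2, hlam, e, hl3, hl4, normCurv_apply, normCurv_apply]
    rw [E2.norm_sq] at *
    simp only [reduceIte, mul_one]
    field_simp
    linear_combination -hsq
  · rw [show (fun q => (liftZ β x g q).g) = g from rfl]
    fin_cases i
    · refine (hP 0).deriv.trans (Eq.trans ?_ (vec_zero ..).symm)
      simp only [l1, l2, r00, r10, r20, PiLp.zero_apply, mul_zero, Finset.sum_const_zero]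
      ring
    · refine (hP 1).deriv.trans (Eq.trans ?_ (vec_one ..).symm)
      simp only [l0, l2, r01, r11, r21, PiLp.zero_apply, mul_zero, Finset.sum_const_zero]
      ring
    · refine (hP 2).deriv.trans (Eq.trans ?_ (vec_two ..).symm)
      simp only [l0, l1, r02, r12, r22, PiLp.zero_apply, mul_zero, Finset.sum_const_zero]
      ring
    -- With ω⁶ = 0, each of w₁', w₂' is the matching body coordinate of (x''/E)', and so minus that
    -- of P, whose x'-term has no such component.
    · refine (w1.fun_neg.congr_of_eventuallyEq (Eventually.of_forall hl3)).deriv.trans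
        (Eq.trans ?_ (vec_three ..).symm)
      rw [l1, hlam, l5]
      simp only [h1, h2, h5, reduceIte, Fin.reduceEq]
      ring
    · refine (w0.congr_of_eventuallyEq (Eventually.of_forall hl4)).deriv.trans
        (Eq.trans ?_ (vec_four ..).symm)
      rw [l0, hlam, l5]
      simp only [h0, h2, h5, reduceIte, Fin.reduceEq]
      ring
    · refine (deriv_const s (0 : ℝ)).trans (Eq.trans ?_ (vec_five ..).symm)
      rw [hl3, hl4, normCurv_apply, normCurv_apply, k0, k1]
      simp only [h0, h1]
      ring

end IsHorizontalLift

end Lift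

end CuspGeo

end

theorem mainTheorem2 (β L : ℝ) (hβ : 0 < β) (hL : 0 < L) :
    -- lifts of stationary curves of the energy are stationary for `∫ ψ`
    (∀ (x₁ n₁ : CuspGeo.E3) (x : ℝ → CuspGeo.E3), ‖n₁‖ = 1 →
      CuspGeo.IsStationaryCurve β L x₁ n₁ x →
      (∃ g : ℝ → CuspGeo.SE3, CuspGeo.IsHorizontalLift L x g) ∧
      ∀ g : ℝ → CuspGeo.SE3, CuspGeo.IsHorizontalLift L x g →
        ∃ Γ : ℝ → CuspGeo.Z,
          (∀ s ∈ Set.Ioo 0 L, (Γ s).g = g s ∧ ((Γ s).σ : ℝ) = 1) ∧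
          CuspGeo.IsStationaryZ β L Γ) ∧
    -- multipliers, normalized curvature and preservation laws along stationary curves in `Z`
    (∀ Γ : ℝ → CuspGeo.Z, CuspGeo.IsStationaryZ β L Γ →
      (∀ s ∈ Set.Ioo 0 L, ((Γ s).σ : ℝ) = 1) →
      -- `Γ` is horizontal and `√(κ₁² + κ₂²)` is the curvature of its spatial part
      (∀ s ∈ Set.Ioo 0 L, (∀ i, CuspGeo.theta Γ s i = 0) ∧
        CuspGeo.curvature (fun q => (Γ q).g.pos) s = ‖(Γ s).κ‖) ∧
      (∀ s ∈ Set.Ioo 0 L,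
        (Γ s).lam 0 = -(deriv (CuspGeo.normCurv β Γ) s) 0 ∧
        (Γ s).lam 1 = -(deriv (CuspGeo.normCurv β Γ) s) 1 ∧
        (Γ s).lam 2 = β * √(1 - ‖CuspGeo.normCurv β Γ s‖ ^ 2) ∧
        (Γ s).lam 3 = -(CuspGeo.normCurv β Γ s) 1 ∧
        (Γ s).lam 4 = (CuspGeo.normCurv β Γ s) 0 ∧
        (Γ s).lam 5 = 0 ∧
        deriv (deriv (CuspGeo.normCurv β Γ)) s = β ^ 2 • CuspGeo.normCurv β Γ s) ∧
      ∃ w₀ v₀ : CuspGeo.E2,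
        Filter.Tendsto (CuspGeo.normCurv β Γ) (nhdsWithin 0 (Set.Ioi 0)) (nhds w₀) ∧
        Filter.Tendsto (deriv (CuspGeo.normCurv β Γ)) (nhdsWithin 0 (Set.Ioi 0)) (nhds v₀) ∧
        (∀ s ∈ Set.Ioo 0 L, CuspGeo.normCurv β Γ s =
          Real.cosh (β * s) • w₀ + (Real.sinh (β * s) / β) • v₀) ∧
        ∃ c : ℝ, c = √(1 - ‖w₀‖ ^ 2 + (β ^ 2)⁻¹ * ‖v₀‖ ^ 2) ∧ 0 < c ∧
          ∀ s ∈ Set.Ioo 0 L,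
            (Γ s).lam 0 ^ 2 + (Γ s).lam 1 ^ 2 + (Γ s).lam 2 ^ 2 = c ^ 2 * β ^ 2 ∧
            (β ^ 2)⁻¹ * (Γ s).lam 2 ^ 2 + (Γ s).lam 3 ^ 2 + (Γ s).lam 4 ^ 2 = 1) := by
  refine ⟨fun x₁ n₁ x _ hx => ⟨CuspGeo.exists_isHorizontalLift hx.smooth hx.unit_speed,
    fun g hg => ⟨CuspGeo.liftZ β x g, fun s _ => ⟨rfl, rfl⟩, hg.isStationaryZ_liftZ hx hβ⟩⟩,
    fun Γ hΓ hσ => ⟨fun s hs => ⟨hΓ.theta_eq_zero hβ hs, ?_⟩, fun s hs => ?_,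
      hΓ.exists_limits hβ hL hσ⟩⟩
  · exact CuspGeo.curvature_eq_of_theta isOpen_Ioo hΓ.smooth hσ
      (fun q hq => hΓ.theta_eq_zero hβ hq) hs
  · obtain ⟨h0, h1⟩ := hΓ.lam_zero_one hβ hσ hs
    exact ⟨h0, h1, hΓ.lam_two_eq_sqrt hβ hs, by rw [hΓ.normCurv_one hβ hs, neg_neg],
      (hΓ.normCurv_zero hβ hs).symm, hΓ.lam_five hβ hs,
      (hΓ.hasDerivAt_deriv_normCurv hβ hσ hs).deriv⟩
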